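/- **Notation.** For a positive integer $m$ let $\zeta_m=e^{2\pi i/m}$, $G_m=\operatorname{Gal}(\mathbb{Q}(\zeta_m)/\mathbb{Q})$ and $N_m=\sum_{\tau\in G_m}\tau\in\mathbb{Q}[G_m]$. For $(s,m)=1$ let $\sigma_s\in G_m$ be the automorphism raising every $m$-th root of unity to its $s$-th power. Write $\langle x\rangle$ for the fractional part of $x$, and for $a\in\mathbb{Z}$ put $$\theta_m(a)=\sum_{\substack{0<s\le m\\(s,m)=1}}\Bigl\langle-\frac{as}{m}\Bigr\rangle\sigma_s^{-1}\in\mathbb{Q}[G_m],\qquad \omega_m(a)=\begin{cases}\theta_m(a)-\tfrac12N_m,&m\nmid a,\\0,&m\mid a.\end{cases}$$ For $n\mid m$ let $\operatorname{res}_{m/n}:\mathbb{Q}[G_m]\to\mathbb{Q}[G_n]$ be the ring homomorphism induced by restriction of automorphisms, and let $\operatorname{cor}_{m/n}:\mathbb{Q}[G_n]\to\mathbb{Q}[G_m]$ be the $\mathbb{Q}$-linear map sending $\tau\in G_n$ to $\sum_{\sigma\in G_m,\ \sigma|_{\mathbb{Q}(\zeta_n)}=\tau}\sigma$. Sinnott's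 group $S'_m$ is the subgroup of the additive group of $\mathbb{Q}[G_m]$ generated by the elements $\operatorname{cor}_{m/(m,n)}\bigl(\operatorname{res}_{n/(m,n)}(\theta_n(a))\bigr)$ for all $a,n\in\mathbb{Z}$ with $n>0$. Let $m>1$ be an integer with $m\not\equiv2\pmod 4$, and write $m=q_1q_2\cdots q_t$ with pairwise coprime prime powers $q_1,\dots,q_t$ (so that every $q_i>2$), in any fixed order. Let $X_m$ be the set of all integers $a$ with $0<a<m$ such that, for each $i$, $a$ is divisible by $q_i$ or relatively prime to $q_i$. Kučera's set $M_m$ is the set of all $a\in X_m$ satisfying - for every $i$, if $q_i\nmid a$ then $a\not\equiv-(a,m)\pmod{q_i}$; - if $a\nmid m$ and $k=\max\{i:\ a\not\equiv(a,m)\pmod{q_i}\}$, then $\Bigl\langle\dfrac{a}{(a,m)\,q_k}\Bigr\rangle<\dfrac12$; - if $a\mid m$, then the number of indices $i$ with $q_i\nmid a$ is odd. **Theorem.** For every integer $m>1$ with $m\not\equiv2\pmod4$, and every ordering of the factors $q_1,\dots,q_t$, the elements $\omega_m(a)$, $a\in M_m$, together with $\tfrac12N_m$, form a $\mathbb{Z}$-basis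 of $S'_m$. -/

import Mathlib

open scoped MonoidAlgebra

noncomputable section

namespace Stickelberger

/-- The `m`-th cyclotomic field `ℚ(ζ_m)`, `ζ_m = exp (2πi/m)`, as a subfield of `ℂ`. -/
def cyclo (m : ℕ) : IntermediateField ℚ ℂ :=
  IntermediateField.adjoin ℚ {Complex.exp (2 * Real.pi * Complex.I / m)}

instance (m : ℕ) [NeZero m] : IsCyclotomicExtension {m} ℚ (cyclo m) :=
  (IntermediateField.isCyclotomicExtension_singleton_iff_eq_adjoin (n := m) ℚ ℂ _
    (Complex.isPrimitiveRoot_exp m (NeZero.ne m))).2 rfl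

instance (m : ℕ) [NeZero m] : FiniteDimensional ℚ (cyclo m) :=
  IsCyclotomicExtension.finiteDimensional {m} ℚ (cyclo m)

instance (m : ℕ) [NeZero m] : IsGalois ℚ (cyclo m) :=
  IsCyclotomicExtension.isGalois {m} ℚ (cyclo m)

instance (m n : ℕ) [NeZero m] : NeZero (Nat.gcd m n) :=
  ⟨Nat.gcd_ne_zero_left (NeZero.ne m)⟩

/-- The Galois group `G_m = Gal(ℚ(ζ_m)/ℚ)`. -/
abbrev G (m : ℕ) : Type := Gal((cyclo m)/ℚ)

/-- If `n ∣ m`, then `ℚ(ζ_n) ⊆ ℚ(ζ_m)`. -/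
theorem cyclo_le {m n : ℕ} [NeZero m] (h : n ∣ m) : cyclo n ≤ cyclo m := by
  unfold cyclo
  rw [IntermediateField.adjoin_simple_le_iff]
  obtain ⟨k, rfl⟩ := h
  have hnk : n * k ≠ 0 := NeZero.ne (n * k)
  have hn : (n : ℂ) ≠ 0 := by exact_mod_cast (Nat.mul_ne_zero_iff.1 hnk).1
  have hk : (k : ℂ) ≠ 0 := by exact_mod_cast (Nat.mul_ne_zero_iff.1 hnk).2
  have e : Complex.exp (2 * Real.pi * Complex.I / n) =
      Complex.exp (2 * Real.pi * Complex.I / (n * k : ℕ)) ^ k := by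
    rw [← Complex.exp_nat_mul]
    congr 1
    push_cast
    field_simp
  rw [e]
  exact pow_mem (IntermediateField.mem_adjoin_simple_self ℚ _) k

/-- Restriction of automorphisms `G_m → G_n`, `σ ↦ σ|_{ℚ(ζ_n)}`, for `n ∣ m`. -/
def restr {m n : ℕ} [NeZero m] [NeZero n] (h : n ∣ m) : G m →* G n :=
  letI : Algebra (cyclo n) (cyclo m) :=
    (IntermediateField.inclusion (cyclo_le h)).toRingHom.toAlgebra
  haveI : IsScalarTower ℚ (cyclo n) (cyclo m) := IsScalarTower.of_algebraMap_eq fun _ => rfl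
  AlgEquiv.restrictNormalHom (cyclo n)

/-- `restr h σ` is indeed the restriction of `σ`. -/
theorem restr_apply {m n : ℕ} [NeZero m] [NeZero n] (h : n ∣ m) (σ : G m) (x : cyclo n) :
    ((restr h σ x : cyclo n) : ℂ) = (σ ⟨x, cyclo_le h x.2⟩ : cyclo m) := by
  let _ : Algebra (cyclo n) (cyclo m) :=
    (IntermediateField.inclusion (cyclo_le h)).toRingHom.toAlgebra
  have : IsScalarTower ℚ (cyclo n) (cyclo m) := IsScalarTower.of_algebraMap_eq fun _ => rfl
  have e : ∀ y : cyclo n, algebraMap (cyclo n) (cyclo m) y = ⟨y, cyclo_le h y.2⟩ :=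
    fun _ => rfl
  have key := AlgEquiv.restrictNormal_commutes σ (cyclo n) x
  rw [e, e] at key
  exact Subtype.ext_iff.1 key

/-- The ring homomorphism `res : ℚ[G_m] → ℚ[G_n]` induced by restriction, for `n ∣ m`. -/
def res {m n : ℕ} [NeZero m] [NeZero n] (h : n ∣ m) : ℚ[G m] →+* ℚ[G n] :=
  MonoidAlgebra.mapDomainRingHom ℚ (restr h)

open Classical in
/-- The linear map `cor : ℚ[G_n] → ℚ[G_m]` with `cor τ = ∑ σ` over all `σ ∈ G_m`
with `σ|_{ℚ(ζ_n)} = τ`, for `n ∣ m`. -/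
def cor {m n : ℕ} [NeZero m] [NeZero n] (h : n ∣ m) : ℚ[G n] →ₗ[ℚ] ℚ[G m] :=
  Finsupp.linearCombination ℚ
      (fun τ : G n => ∑ σ : G m with restr h σ = τ, MonoidAlgebra.single σ (1 : ℚ)) ∘ₗ
    (MonoidAlgebra.coeffLinearEquiv ℚ).toLinearMap

open Classical in
theorem cor_single {m n : ℕ} [NeZero m] [NeZero n] (h : n ∣ m) (τ : G n) (c : ℚ) :
    cor h (MonoidAlgebra.single τ c) =
      c • ∑ σ : G m with restr h σ = τ, MonoidAlgebra.single σ (1 : ℚ) := by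
  simp [cor]

/-- The automorphism `σ_s ∈ G_m` sending every `m`-th root of unity to its `s`-th power, for `s`
coprime to `m` (with the irrelevant value `1` for other `s`). -/
def sigma (m : ℕ) [NeZero m] (s : ℕ) : G m :=
  if h : s.Coprime m then
    (IsCyclotomicExtension.autEquivPow (cyclo m)
      (Polynomial.cyclotomic.irreducible_rat (NeZero.pos m))).symm (ZMod.unitOfCoprime s h)
  else 1

/-- `sigma m s` is indeed `ζ ↦ ζ ^ s` on `m`-th roots of unity. -/
theorem sigma_apply (m : ℕ) [NeZero m] {s : ℕ} (hs : s.Coprime m) (x : cyclo m)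
    (hx : x ^ m = 1) : sigma m s x = x ^ s := by
  have hζ : IsPrimitiveRoot (IsCyclotomicExtension.zeta m ℚ (cyclo m)) m :=
    IsCyclotomicExtension.zeta_spec m ℚ (cyclo m)
  have hu : IsCyclotomicExtension.autEquivPow (cyclo m)
      (Polynomial.cyclotomic.irreducible_rat (NeZero.pos m)) (sigma m s) =
      ZMod.unitOfCoprime s hs := by
    rw [sigma, dif_pos hs, MulEquiv.apply_symm_apply]
  have hval : ((hζ.autToPow ℚ (sigma m s) : (ZMod m)ˣ) : ZMod m) = s := by
    have := congrArg (fun u : (ZMod m)ˣ => (u : ZMod m)) hu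
    simpa using this
  have key := hζ.autToPow_spec ℚ (sigma m s)
  rw [hval, ZMod.val_natCast] at key
  obtain ⟨i, -, rfl⟩ := hζ.eq_pow_of_pow_eq_one hx
  rw [map_pow, ← key, pow_right_comm, pow_eq_pow_mod s hx]

/-- `θ_m(a) = ∑_{0 < s ≤ m, (s,m) = 1} ⟨-as/m⟩ σ_s⁻¹ ∈ ℚ[G_m]`. -/
def theta (m : ℕ) [NeZero m] (a : ℤ) : ℚ[G m] :=
  ∑ s ∈ Finset.Ioc 0 m with s.Coprime m,
    MonoidAlgebra.single (sigma m s)⁻¹ (Int.fract (-((a : ℚ) * s) / m))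

/-- The absolute norm element `N_m = ∑_{τ ∈ G_m} τ`. -/
def normElt (m : ℕ) [NeZero m] : ℚ[G m] :=
  ∑ τ : G m, MonoidAlgebra.single τ 1

/-- `θ_n^{(m)}(a) = cor (res (θ_n(a)))`, the maps being those for `ℚ(ζ_m)/ℚ(ζ_(m,n))` and
`ℚ(ζ_n)/ℚ(ζ_(m,n))`. -/
def thetaRel (m n : ℕ) [NeZero m] [NeZero n] (a : ℤ) : ℚ[G m] :=
  cor (Nat.gcd_dvd_left m n) (res (Nat.gcd_dvd_right m n) (theta n a))

/-- Sinnott's group `S'_m`: the additive subgroup of `ℚ[G_m]` generated by all `θ_n^{(m)}(a)`,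
`a, n ∈ ℤ`, `n > 0`. -/
def sinnottGroup (m : ℕ) [NeZero m] : AddSubgroup ℚ[G m] :=
  AddSubgroup.closure {x | ∃ (n : ℕ) (_ : NeZero n) (a : ℤ), x = thetaRel m n a}

/-- `ω_m(a) = θ_m(a) - ½ N_m` if `m ∤ a`, and `ω_m(a) = 0` if `m ∣ a`. -/
def omega (m : ℕ) [NeZero m] (a : ℤ) : ℚ[G m] :=
  if (m : ℤ) ∣ a then 0 else theta m a - (1 / 2 : ℚ) • normElt m

/-- The set `X_m` of all integers `0 < a < m` that, for every `i`, are divisible by `q_i` or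
relatively prime to `q_i`. -/
def setX (m : ℕ) {t : ℕ} (q : Fin t → ℕ) : Set ℤ :=
  {a | 0 < a ∧ a < m ∧ ∀ i, (q i : ℤ) ∣ a ∨ IsCoprime a (q i : ℤ)}

/-- Kučera's set `M_m`, for the ordered factorization `m = q_1 ⋯ q_t` into powers of distinct
primes. -/
def setM (m : ℕ) {t : ℕ} (q : Fin t → ℕ) : Set ℤ :=
  {a | a ∈ setX m q ∧
    (∀ i, ¬ (q i : ℤ) ∣ a → ¬ a ≡ -(Int.gcd a m : ℤ) [ZMOD q i]) ∧
    (¬ a ∣ m → ∀ k, IsGreatest {i | ¬ a ≡ (Int.gcd a m : ℤ) [ZMOD q i]} k →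
      Int.fract ((a : ℚ) / ((Int.gcd a m : ℚ) * q k)) < 1 / 2) ∧
    (a ∣ m → Odd {i | ¬ (q i : ℤ) ∣ a}.ncard)}

end Stickelberger

end

/-! Recording an element of ℚ[G_m] by its coefficients at the σ_u⁻¹ turns ω_m(a) into the function u
↦ saw(-au/m) on (ℤ/m)ˣ, `res` into summation over fibres and `cor` into pullback. The distribution
relation of the sawtooth makes the sawtooth functions stable under both maps, and θ_2(1) contributes
the constant ½. Hence S'_m is generated by all sawtooth functions and ½ (`sinnottGroup_eq`).

Generation. By the distribution relation it suffices to treat those a whose residue modulo each q_i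
is zero or a unit. Such an a is encoded by a tuple x, and x ↦ Ω(x) is odd and satisfies a norm
relation at each index (`tupleSaw_isSignedDistribution`). Norm relations remove the coordinates -1,
and oddness moves the last coordinate other than 0 and 1 into a half system (`mem_of_kuceraSet`).
There remain the tuples with entries in {0, 1} and support of even size. They need a further
relation (`sum_half_mem`): the sum of Ω over a product of half systems on an even set is a
combination of values with smaller support. The norm relations and oddness give twice such a
relation, by a zigzag between the Koszul complex of the norm relations and the action of -1; the
factor 2 is cancelled because the target has no 2-torsion.

Independence. An involution shows 2|M_m| ≤ φ(m) (`two_mul_ncard_kuceraSet_le`). Over ℂ the sawtooth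
functions span all φ(m)/2 odd characters, because L(1, χ) ≠ 0
(`DirichletCharacter.Odd.mem_span_saw`). So the generating family, enlarged by a constant, has no
room for a linear relation. -/

section

open Finset

set_option linter.unusedSectionVars false

/-! ### Koszul signs and alternating bit patterns. -/

section SignedParity

variable {ι : Type*} [LinearOrder ι]

/-- The Koszul sign of `i` in the finite set `S`. -/
def koszulSign (S : Finset ι) (i : ι) : ℤ := (-1) ^ #{l ∈ S | l < i}

/-- Removing the smaller index flips the sign of the larger one, while removing the larger does not
affect the smaller. Double sums of commuting boundaries therefore cancel. -/
theorem koszulSign_antisymm {S : Finset ι} {i l : ι} (hi : i ∈ S) (hl : l ∈ S) (h : i ≠ l) :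
    koszulSign S i * koszulSign (S.erase i) l = -(koszulSign S l * koszulSign (S.erase l) i) := by
  wlog hlt : i < l generalizing i l
  · rw [this hl hi h.symm (lt_of_le_of_ne (not_lt.1 hlt) h.symm), neg_neg]
  have h1 : koszulSign (S.erase l) i = koszulSign S i := by
    unfold koszulSign
    congr 2
    ext x
    simp only [mem_filter, mem_erase]
    refine ⟨fun hx => ⟨hx.1.2, hx.2⟩, fun hx => ⟨⟨?_, hx.1⟩, hx.2⟩⟩
    rintro rfl
    exact absurd hx.2 hlt.not_gt
  have h2 : koszulSign S l = -koszulSign (S.erase i) l := by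
    unfold koszulSign
    have : ({x ∈ S | x < l} : Finset ι) = insert i {x ∈ S.erase i | x < l} := by
      ext x
      simp only [mem_filter, mem_erase, mem_insert]
      by_cases hx : x = i
      · subst hx; simp [hi, hlt]
      · simp [hx]
    rw [this, card_insert_of_notMem (by simp), pow_succ]
    ring
  rw [h1, h2]
  ring

/-- Indicator of the alternating bit pattern on `S` that is `true` at the largest index. -/
def alternating (S : Finset ι) (b : ι → Bool) : ℤ :=
  ∏ i ∈ S, if b i = decide (Even #{l ∈ S | i < l}) then 1 else 0

theorem alternating_congr {S : Finset ι} {b c : ι → Bool} (h : ∀ i ∈ S, b i = c i) :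
    alternating S b = alternating S c :=
  prod_congr rfl fun i hi => by rw [h i hi]

theorem alternating_insert {a : ι} {s : Finset ι} (h : ∀ x ∈ s, a < x) (b : ι → Bool) :
    alternating (insert a s) b =
      (if b a = decide (Even #s) then 1 else 0) * alternating s b := by
  have ha : a ∉ s := fun h' => lt_irrefl _ (h a h')
  unfold alternating
  rw [prod_insert ha]
  congr 1
  · rw [show ({l ∈ insert a s | a < l} : Finset ι) = s from ?_]
    ext x
    simp only [mem_filter, mem_insert]
    exact ⟨fun hx => hx.1.resolve_left hx.2.ne', fun hx => ⟨Or.inr hx, h x hx⟩⟩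
  · refine prod_congr rfl fun i hi => ?_
    rw [show ({l ∈ insert a s | i < l} : Finset ι) = {l ∈ s | i < l} from ?_]
    ext x
    simp only [mem_filter, mem_insert]
    refine ⟨fun hx => ⟨hx.1.resolve_left ?_, hx.2⟩, fun hx => ⟨Or.inr hx.1, hx.2⟩⟩
    rintro rfl
    exact lt_asymm hx.2 (h i hi)

/-- Add a new smallest index `a`: its own sign is 1, all the other signs flip, and the bit `b a`
decides which terms survive. The identity gives the values of the chains on tuples of full support.
-/
theorem sum_koszulSign_mul_alternating (S : Finset ι) (b : ι → Bool) :
    ∑ i ∈ S, koszulSign S i * alternating (S.erase i) b =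
      alternating S b - (-1) ^ #S * alternating S (fun i => !b i) := by
  induction S using Finset.induction_on_min with
  | empty => simp [alternating]
  | insert a s h ih =>
    have ha : a ∉ s := fun h' => lt_irrefl _ (h a h')
    have h1 : koszulSign (insert a s) a = 1 := by
      unfold koszulSign
      rw [show ({l ∈ insert a s | l < a} : Finset ι) = ∅ from ?_]
      · simp
      · ext x
        simp only [mem_filter, mem_insert, notMem_empty, iff_false, not_and]
        rintro (rfl | hx)
        · exact lt_irrefl _
        · exact (h x hx).not_gt
    have h2 : ∀ i ∈ s, koszulSign (insert a s) i * alternating ((insert a s).erase i) b =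
        -(if b a = decide (Even #s) then 0 else 1) *
          (koszulSign s i * alternating (s.erase i) b) := by
      intro i hi
      have hai : a ≠ i := fun h' => ha (h' ▸ hi)
      rw [erase_insert_of_ne hai, alternating_insert (fun x hx => h x (mem_of_mem_erase hx)),
        card_erase_of_mem hi]
      have : koszulSign (insert a s) i = -koszulSign s i := by
        unfold koszulSign
        rw [filter_insert, if_pos (h i hi), card_insert_of_notMem (by simp [ha]), pow_succ]
        ring
      rw [this]
      have hpos : 0 < #s := card_pos.2 ⟨i, hi⟩
      obtain ⟨n, hn⟩ : ∃ n, #s = n + 1 := ⟨#s - 1, by omega⟩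
      rw [hn, Nat.add_sub_cancel]
      have : Even (n + 1) ↔ ¬ Even n := Nat.even_add_one
      by_cases he : Even n <;> cases b a <;> simp [he, this]
    rw [sum_insert ha, h1, erase_insert ha, sum_congr rfl h2, ← mul_sum, ih,
      alternating_insert h, alternating_insert h, card_insert_of_notMem ha, pow_succ]
    cases b a <;> by_cases he : Even #s <;> simp [he]

end SignedParity

/-! ### Boundary operators and the Koszul zigzag. -/

namespace SignedDistribution

variable {ι : Type*} [Fintype ι] [LinearOrder ι] {K : ι → Type*}
  [∀ i, CommGroupWithZero (K i)] [∀ i, DecidableEq (K i)]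

/-- The support of a tuple. -/
def supp (x : ∀ i, K i) : Finset ι := {i | x i ≠ 0}

@[simp] theorem mem_supp {x : ∀ i, K i} {i : ι} : i ∈ supp x ↔ x i ≠ 0 := by simp [supp]

theorem supp_mul {a : ∀ i, K i} (ha : ∀ i, a i ≠ 0) (x : ∀ i, K i) : supp (a * x) = supp x := by
  ext i; simp [ha i]

theorem supp_update_zero (x : ∀ i, K i) (i : ι) :
    supp (Function.update x i 0) = (supp x).erase i := by
  ext l
  by_cases h : l = i
  · subst h; simp
  · simp [h]

theorem supp_update_of_ne_zero {x : ∀ i, K i} {i : ι} {g : K i} (hg : g ≠ 0) :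
    supp (Function.update x i g) = insert i (supp x) := by
  ext l
  by_cases h : l = i
  · subst h; simp [hg]
  · simp [h]

theorem mul_update (a x : ∀ i, K i) (i : ι) (g : K i) :
    a * Function.update x i g = Function.update (a * x) i (a i * g) := by
  ext l
  by_cases h : l = i
  · subst h; simp
  · simp [h]

theorem mul_update_zero (a x : ∀ i, K i) (i : ι) :
    a * Function.update x i 0 = Function.update (a * x) i 0 := by
  rw [mul_update, mul_zero]

/-- The boundary operator attached to the index `i`, on functions of tuples. -/
def boundary (P Q : ι → ∀ i, K i) (i : ι) (f : (∀ i, K i) → ℤ) (x : ∀ i, K i) : ℤ :=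
  if x i = 0 then f (Q i * x) - f (P i * x) else f (Function.update x i 0)

section boundary

variable {P Q : ι → ∀ i, K i} (hP : ∀ i l, P i l ≠ 0) (hQ : ∀ i l, Q i l ≠ 0)

theorem boundary_sum (i : ι) {α : Type*} (s : Finset α) (c : α → ℤ) (f : α → (∀ i, K i) → ℤ) :
    boundary P Q i (fun x => ∑ l ∈ s, c l * f l x) =
      fun x => ∑ l ∈ s, c l * boundary P Q i (f l) x := by
  ext x
  unfold boundary
  split_ifs <;> simp [mul_sub]

theorem boundary_sub_mul (i : ι) (c : ℤ) (f g : (∀ i, K i) → ℤ) (x : ∀ i, K i) :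
    boundary P Q i (fun x => f x - c * g x) x =
      boundary P Q i f x - c * boundary P Q i g x := by
  unfold boundary
  split_ifs <;> ring

theorem boundary_comp_mul {j : ∀ i, K i} (hj : ∀ i, j i ≠ 0) (i : ι) (f : (∀ i, K i) → ℤ)
    (x : ∀ i, K i) :
    boundary P Q i (fun x => f (j * x)) x = boundary P Q i f (j * x) := by
  unfold boundary
  simp only [Pi.mul_apply, mul_eq_zero, hj i, false_or, mul_update_zero, mul_left_comm j]

include hP hQ in
-- The operators set different coordinates to zero, and multiplication by a tuple without zero
-- entries does not change which coordinates vanish.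
theorem boundary_comm {i l : ι} (h : i ≠ l) (f : (∀ i, K i) → ℤ) :
    boundary P Q i (boundary P Q l f) = boundary P Q l (boundary P Q i f) := by
  ext x
  unfold boundary
  by_cases hi : x i = 0 <;> by_cases hl : x l = 0
  · simp only [hi, hl, if_true, Pi.mul_apply, mul_zero, mul_left_comm (Q l), mul_left_comm (P l)]
    ring
  · simp [hi, hl, hP, hQ, h, mul_update_zero]
  · simp [hi, hl, hP, hQ, h.symm, mul_update_zero]
  · simp [hi, hl, h, h.symm, Function.update_comm h]

include hP hQ in
theorem boundary_eq_zero {i : ι} {S : Finset ι} (hi : i ∈ S) {f : (∀ i, K i) → ℤ}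
    (hf : ∀ x, f x ≠ 0 → supp x ⊆ S.erase i) {x : ∀ i, K i} (hx : boundary P Q i f x ≠ 0) :
    supp x ⊆ S := by
  unfold boundary at hx
  split_ifs at hx with h
  · have : f (Q i * x) ≠ 0 ∨ f (P i * x) ≠ 0 := by
      by_contra! h'
      simp [h'] at hx
    rcases this with h' | h'
    · have := hf _ h'
      rw [supp_mul (hQ i)] at this
      exact this.trans (erase_subset _ _)
    · have := hf _ h'
      rw [supp_mul (hP i)] at this
      exact this.trans (erase_subset _ _)
  · have := hf _ hx
    rw [supp_update_zero] at this
    intro l hl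
    by_cases hli : l = i
    · exact hli ▸ hi
    · exact mem_of_mem_erase (this (mem_erase.2 ⟨hli, hl⟩))

end boundary

/-- The tuples whose last nonzero coordinate lies in the given half system. -/
def IsHalf (H : ∀ i, Finset (K i)) (x : ∀ i, K i) : Prop :=
  ∃ k, x k ≠ 0 ∧ (∀ i, k < i → x i = 0) ∧ x k ∈ H k

theorem isHalf_iff_mem {H : ∀ i, Finset (K i)} {x : ∀ i, K i} {k : ι} (hk : x k ≠ 0)
    (h : ∀ i, k < i → x i = 0) : IsHalf H x ↔ x k ∈ H k := by
  refine ⟨?_, fun h' => ⟨k, hk, h, h'⟩⟩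
  rintro ⟨l, hl, hl', hm⟩
  rcases lt_trichotomy k l with hkl | rfl | hkl
  · exact absurd (h l hkl) hl
  · exact hm
  · exact absurd (hl' k hkl) hk

theorem exists_last {x : ∀ i, K i} (hx : x ≠ 0) : ∃ k, x k ≠ 0 ∧ ∀ i, k < i → x i = 0 := by
  have hne : (supp x).Nonempty := by
    obtain ⟨i, hi⟩ := Function.ne_iff.1 hx
    exact ⟨i, by simpa using hi⟩
  refine ⟨(supp x).max' hne, by simpa using (supp x).max'_mem hne, fun i hi => ?_⟩
  by_contra h
  exact absurd ((supp x).le_max' i (by simpa using h)) (not_le.2 hi)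

/-- The sign preserves the position of the last nonzero coordinate, so the tuples satisfying
`IsHalf` represent the nonzero tuples modulo the sign. -/
theorem isHalf_mul {H : ∀ i, Finset (K i)} {j : ∀ i, K i} (hj : ∀ i, j i ≠ 0)
    (hH : ∀ i x, x ≠ 0 → (j i * x ∈ H i ↔ x ∉ H i)) {x : ∀ i, K i} (hx : x ≠ 0) :
    IsHalf H (j * x) ↔ ¬ IsHalf H x := by
  obtain ⟨k, hk, hk'⟩ := exists_last hx
  rw [isHalf_iff_mem hk hk', isHalf_iff_mem (k := k) (by simp [hj, hk])
    (fun i hi => by simp [hk' i hi]), Pi.mul_apply, hH k _ hk]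

open Classical in
/-- The chains obtained by the zigzag through the Koszul complex, starting from the zero tuple. -/
noncomputable def chain (P Q : ι → ∀ i, K i) (H : ∀ i, Finset (K i)) (S : Finset ι) :
    (∀ i, K i) → ℤ :=
  if S = ∅ then fun x => if x = 0 then 1 else 0
  else fun x => if IsHalf H x then
    ∑ i ∈ S.attach, koszulSign S i * boundary P Q i (chain P Q H (S.erase i)) x else 0
termination_by #S
decreasing_by exact card_erase_lt_of_mem i.2

/-- The signed sum of the boundaries of the preceding chains. -/
noncomputable def chainBoundary (P Q : ι → ∀ i, K i) (H : ∀ i, Finset (K i)) (S : Finset ι)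
    (x : ∀ i, K i) : ℤ :=
  ∑ i ∈ S, koszulSign S i * boundary P Q i (chain P Q H (S.erase i)) x

variable {P Q : ι → ∀ i, K i} {H : ∀ i, Finset (K i)}

open Classical in
theorem chain_empty (x : ∀ i, K i) : chain P Q H ∅ x = if x = 0 then 1 else 0 := by
  rw [chain, if_pos rfl]

open Classical in
theorem chain_of_nonempty {S : Finset ι} (hS : S.Nonempty) (x : ∀ i, K i) :
    chain P Q H S x = if IsHalf H x then chainBoundary P Q H S x else 0 := by
  rw [chain, if_neg hS.ne_empty]
  simp only [chainBoundary]
  rw [← sum_attach S]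

theorem chain_support (hP : ∀ i l, P i l ≠ 0) (hQ : ∀ i l, Q i l ≠ 0) (S : Finset ι)
    {x : ∀ i, K i} (hx : chain P Q H S x ≠ 0) : supp x ⊆ S := by
  induction hn : #S using Nat.strong_induction_on generalizing S x with
  | _ n ih =>
    rcases S.eq_empty_or_nonempty with rfl | hS
    · rw [chain_empty] at hx
      have : x = 0 := by
        by_contra h
        simp [h] at hx
      simp [this, supp]
    · rw [chain_of_nonempty hS] at hx
      have : chainBoundary P Q H S x ≠ 0 := by
        intro h
        simp [h] at hx
      obtain ⟨i, hi, h⟩ := exists_ne_zero_of_sum_ne_zero this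
      exact boundary_eq_zero hP hQ hi
        (fun z hz => ih _ (hn ▸ card_erase_lt_of_mem hi) _ hz rfl) (right_ne_zero_of_mul h)

theorem chainBoundary_zero (S : Finset ι) : chainBoundary P Q H S 0 = 0 := by
  refine sum_eq_zero fun i _ => ?_
  simp [boundary]

theorem sum_sum_erase_antisymm {S : Finset ι} (F : ι → ι → ℤ)
    (hF : ∀ i ∈ S, ∀ l ∈ S, i ≠ l → F i l = -F l i) :
    ∑ i ∈ S, ∑ l ∈ S.erase i, F i l = 0 := by
  have e : ∀ F : ι → ι → ℤ, ∑ i ∈ S, ∑ l ∈ S.erase i, F i l =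
      ∑ i ∈ S, ∑ l ∈ S, if i ≠ l then F i l else 0 := by
    intro F
    refine sum_congr rfl fun i _ => ?_
    rw [← sum_filter]
    refine sum_congr ?_ fun _ _ => rfl
    ext l
    simp [eq_comm, and_comm]
  have h1 : ∑ i ∈ S, ∑ l ∈ S.erase i, F i l = -∑ i ∈ S, ∑ l ∈ S.erase i, F i l := by
    conv_lhs => rw [e, sum_comm]
    rw [e, ← sum_neg_distrib]
    refine sum_congr rfl fun i hi => ?_
    rw [← sum_neg_distrib]
    refine sum_congr rfl fun l hl => ?_
    by_cases h : i = l
    · simp [h]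
    · rw [if_pos (Ne.symm h), if_pos h, hF l hl i hi (Ne.symm h)]
  omega

/-- The chain boundary D satisfies D(jx) = -(-1)^#S D(x). Cutting D down to representatives modulo
the sign thus yields a function from which D is recovered by (anti)symmetrization. -/
theorem chain_sub_chain_mul (hP : ∀ i l, P i l ≠ 0) (hQ : ∀ i l, Q i l ≠ 0) {j : ∀ i, K i}
    (hj : ∀ i, j i ≠ 0)
    (hH : ∀ i x, x ≠ 0 → (j i * x ∈ H i ↔ x ∉ H i)) (S : Finset ι) (x : ∀ i, K i) :
    chain P Q H S x - (-1) ^ #S * chain P Q H S (j * x) = chainBoundary P Q H S x := by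
  induction hn : #S using Nat.strong_induction_on generalizing S x with
  | _ n ih =>
    subst hn
    have hj0 : ∀ x : ∀ i, K i, j * x = 0 ↔ x = 0 := fun x => by
      simp [funext_iff, hj]
    rcases S.eq_empty_or_nonempty with rfl | hS
    · simp [chain_empty, chainBoundary, hj0]
    -- By induction each symmetrized chain on `S.erase i` is itself a chain boundary. The result is
    -- a double sum of ∂_i ∂_l with antisymmetric signs, which vanishes.
    have key : chainBoundary P Q H S x + (-1) ^ #S * chainBoundary P Q H S (j * x) = 0 := by
      have : chainBoundary P Q H S x + (-1) ^ #S * chainBoundary P Q H S (j * x) =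
          ∑ i ∈ S, ∑ l ∈ S.erase i, koszulSign S i * koszulSign (S.erase i) l *
            boundary P Q i (boundary P Q l (chain P Q H ((S.erase i).erase l))) x := by
        unfold chainBoundary
        rw [mul_sum, ← sum_add_distrib]
        refine sum_congr rfl fun i hi => ?_
        have hc : #(S.erase i) + 1 = #S := card_erase_add_one hi
        have h1 : chainBoundary P Q H (S.erase i) = fun x => chain P Q H (S.erase i) x -
            (-1) ^ #(S.erase i) * chain P Q H (S.erase i) (j * x) := by
          ext z
          rw [ih _ (by omega) _ z rfl]
        have h2 : boundary P Q i (chainBoundary P Q H (S.erase i)) x =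
            ∑ l ∈ S.erase i, koszulSign (S.erase i) l *
              boundary P Q i (boundary P Q l (chain P Q H ((S.erase i).erase l))) x := by
          unfold chainBoundary
          rw [boundary_sum]
        simp only [mul_assoc]
        rw [← mul_sum, ← h2, h1, boundary_sub_mul, boundary_comp_mul hj, ← hc, pow_succ]
        ring
      rw [this]
      refine sum_sum_erase_antisymm _ fun i hi l hl h => ?_
      rw [koszulSign_antisymm hi hl h, boundary_comm hP hQ h, erase_right_comm, neg_mul]
    rw [chain_of_nonempty hS, chain_of_nonempty hS]
    by_cases hx : x = 0
    · subst hx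
      simp [chainBoundary_zero]
    · rw [isHalf_mul hj hH hx]
      by_cases hh : IsHalf H x
      · simp [hh]
      · simp only [hh, if_false, not_false_eq_true, if_true]
        linarith

/-- If the support is all of `S`, every boundary just erases a coordinate and the terms in `P` and
`Q` do not occur. The recursion is then that of `sum_koszulSign_mul_alternating`, and `IsHalf` keeps
the pattern that is `true` at the last index. -/
theorem chain_top (S : Finset ι) {x : ∀ i, K i} (hx : supp x = S) :
    chain P Q H S x = alternating S fun i => decide (x i ∈ H i) := by
  induction hn : #S using Nat.strong_induction_on generalizing S x with
  | _ n ih =>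
    subst hn
    rcases S.eq_empty_or_nonempty with rfl | hS
    · have : x = 0 := by
        ext i
        by_contra h
        have : i ∈ supp x := by simpa using h
        simp [hx] at this
      simp [chain_empty, alternating, this]
    have h1 : chainBoundary P Q H S x = alternating S (fun i => decide (x i ∈ H i)) -
        (-1) ^ #S * alternating S (fun i => !decide (x i ∈ H i)) := by
      rw [← sum_koszulSign_mul_alternating]
      refine sum_congr rfl fun i hi => ?_
      have hxi : x i ≠ 0 := by rwa [← mem_supp, hx]
      rw [boundary, if_neg hxi, ih _ (card_erase_lt_of_mem hi) (S.erase i)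
        (by rw [supp_update_zero, hx]) rfl]
      congr 1
      refine alternating_congr fun l hl => ?_
      rw [Function.update_of_ne (ne_of_mem_erase hl)]
    have hk := S.max'_mem hS
    set k := S.max' hS with hkdef
    have hlast : ∀ i, k < i → x i = 0 := fun i hi => by
      by_contra h
      rw [← Ne, ← mem_supp, hx] at h
      exact absurd (S.le_max' i h) (not_le.2 hi)
    have hxk : x k ≠ 0 := by rwa [← mem_supp, hx]
    have hmax : ∀ b : ι → Bool, b k = false → alternating S b = 0 := by
      intro b hb
      refine prod_eq_zero hk ?_
      have : ({l ∈ S | k < l} : Finset ι) = ∅ := by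
        ext l
        simp only [mem_filter, notMem_empty, iff_false, not_and, not_lt]
        exact fun hl => S.le_max' l hl
      simp [this, hb]
    rw [chain_of_nonempty hS, isHalf_iff_mem hxk hlast, h1]
    by_cases hkH : x k ∈ H k
    · rw [if_pos hkH, hmax (fun i => !decide (x i ∈ H i)) (by simp [hkH])]
      ring
    · rw [if_neg hkH, hmax (fun i => decide (x i ∈ H i)) (by simp [hkH])]

end SignedDistribution

/-! ### Signed distributions: the even relation and generation by Kučera's set. -/

namespace SignedDistribution

variable {ι : Type*} [Fintype ι] [LinearOrder ι] {K : ι → Type*}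
  [∀ i, CommGroupWithZero (K i)] [∀ i, DecidableEq (K i)] [∀ i, Fintype (K i)]
  {V : Type*} [AddCommGroup V]

theorem sum_eq_sum_update (i : ι) (F : (∀ i, K i) → V) :
    ∑ x, F x = ∑ x with x i = 0, ∑ g, F (Function.update x i g) := by
  rw [← sum_fiberwise_of_maps_to (s := univ) (t := {x : ∀ i, K i | x i = 0})
    (g := fun x => Function.update x i 0) (by simp)]
  refine sum_congr rfl fun x hx => ?_
  have hx : x i = 0 := by simpa using hx
  refine sum_bij' (fun z _ => z i) (fun g _ => Function.update x i g) (by simp) ?_ ?_ (by simp) ?_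
  · intro g _
    simp [← hx]
  · intro z hz
    have hz : Function.update z i 0 = x := by simpa using hz
    simp [← hz]
  · intro z hz
    have hz : Function.update z i 0 = x := by simpa using hz
    simp [← hz]

/-- A signed distribution: an odd function of tuples satisfying norm relations, in which
`A i` and `B i` describe the Frobenius operators at the index `i`. -/
structure IsSignedDistribution (j : ∀ i, K i) (A B : ι → ∀ i, K i) (Ω : (∀ i, K i) → V) :
    Prop where
  ne_zero_left : ∀ i l, A i l ≠ 0
  ne_zero_right : ∀ i l, B i l ≠ 0
  sign_mul_self : j * j = 1
  odd : ∀ x, Ω (j * x) = -Ω x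
  norm : ∀ i x, x i = 0 →
    ∑ g with g ≠ 0, Ω (Function.update x i g) = Ω (A i * x) - Ω (B i * x)

theorem sum_comp_inv_mul {a : ∀ i, K i} (ha : ∀ i, a i ≠ 0) (i : ι) (F : (∀ i, K i) → V) :
    ∑ x with x i = 0, F (a⁻¹ * x) = ∑ x with x i = 0, F x := by
  have h1 : a * a⁻¹ = 1 := by ext l; simp [ha l]
  have h2 : a⁻¹ * a = 1 := by ext l; simp [ha l]
  refine sum_bij' (fun x _ => a⁻¹ * x) (fun x _ => a * x) ?_ ?_ ?_ ?_ (by simp)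
  · simp +contextual
  · simp +contextual
  · intro x _; rw [← mul_assoc, h1, one_mul]
  · intro x _; rw [← mul_assoc, h2, one_mul]

namespace IsSignedDistribution

variable {j : ∀ i, K i} {A B : ι → ∀ i, K i} {Ω : (∀ i, K i) → V}

theorem sign_ne_zero (h : IsSignedDistribution j A B Ω) (i : ι) : j i ≠ 0 := by
  intro h0
  have := congrFun h.sign_mul_self i
  simp [h0] at this

/-- `boundary` is the adjoint of the norm relation: the pairing is the sum over tuples with `x i =
0` of `f x` times the relation at `x`, after the translations by `A i` and `B i` are moved from Ω to
`f`. -/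
theorem sum_boundary (h : IsSignedDistribution j A B Ω) (i : ι)
    (f : (∀ i, K i) → ℤ) :
    ∑ x, boundary (fun i => (A i)⁻¹) (fun i => (B i)⁻¹) i f x • Ω x = 0 := by
  have key : ∀ x : ∀ i, K i, x i = 0 →
      ∑ g, boundary (fun i => (A i)⁻¹) (fun i => (B i)⁻¹) i f (Function.update x i g) •
        Ω (Function.update x i g) =
      (f ((B i)⁻¹ * x) • Ω x - f ((A i)⁻¹ * x) • Ω x) +
        (f x • Ω (A i * x) - f x • Ω (B i * x)) := by
    intro x hx
    rw [← smul_sub, ← h.norm i x hx, ← sum_filter_add_sum_filter_not univ (fun g : K i => g = 0)]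
    have e : Function.update x i 0 = x := by rw [← hx, Function.update_eq_self]
    congr 1
    · rw [filter_eq', if_pos (mem_univ _), sum_singleton, boundary, if_pos (by simp), e, sub_smul]
    · rw [smul_sum]
      refine sum_congr rfl fun g hg => ?_
      have hg : g ≠ 0 := by simpa using hg
      rw [boundary, if_neg (by simpa using hg), Function.update_idem, e]
  rw [sum_eq_sum_update i, sum_congr rfl fun x hx => key x (by simpa using hx), sum_add_distrib,
    sum_sub_distrib, sum_sub_distrib]
  have e1 := sum_comp_inv_mul (h.ne_zero_left i) i fun x => f x • Ω (A i * x)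
  have e2 := sum_comp_inv_mul (h.ne_zero_right i) i fun x => f x • Ω (B i * x)
  have h1 : ∀ x, A i * ((A i)⁻¹ * x) = x := fun x => by ext l; simp [h.ne_zero_left i l]
  have h2 : ∀ x, B i * ((B i)⁻¹ * x) = x := fun x => by ext l; simp [h.ne_zero_right i l]
  simp only [h1, h2] at e1 e2
  rw [e1, e2]
  abel

/-- For even `#S` the chain boundary is c - c∘j. Pairing it with the odd function Ω gives twice the
pairing of c, and gives zero by the norm relations; `hV` cancels the 2. -/
theorem sum_chain (h : IsSignedDistribution j A B Ω) (hV : ∀ v : V, v + v = 0 → v = 0)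
    {H : ∀ i, Finset (K i)} (hH : ∀ i x, x ≠ 0 → (j i * x ∈ H i ↔ x ∉ H i))
    {S : Finset ι} (hS : Even #S) :
    ∑ x, chain (fun i => (A i)⁻¹) (fun i => (B i)⁻¹) H S x • Ω x = 0 := by
  have hP : ∀ i l, (fun i => (A i)⁻¹) i l ≠ 0 := fun i l => by simp [h.ne_zero_left i l]
  have hQ : ∀ i l, (fun i => (B i)⁻¹) i l ≠ 0 := fun i l => by simp [h.ne_zero_right i l]
  set c := chain (fun i => (A i)⁻¹) (fun i => (B i)⁻¹) H with hc
  have h0 : ∑ x, chainBoundary (fun i => (A i)⁻¹) (fun i => (B i)⁻¹) H S x • Ω x = 0 := by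
    simp only [chainBoundary, sum_smul, mul_smul]
    rw [sum_comm]
    refine sum_eq_zero fun i hi => ?_
    rw [← smul_sum, h.sum_boundary, smul_zero]
  have h1 : ∑ x, c S (j * x) • Ω x = -∑ x, c S x • Ω x := by
    rw [← sum_neg_distrib]
    have hjj : ∀ x, j * (j * x) = x := fun x => by rw [← mul_assoc, h.sign_mul_self, one_mul]
    refine sum_bij' (fun x _ => j * x) (fun x _ => j * x) (by simp) (by simp) (by simp [hjj])
      (by simp [hjj]) fun x _ => ?_
    rw [h.odd, smul_neg, neg_neg]
  refine hV _ ?_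
  rw [← h0]
  conv_lhs => rw [← neg_neg (∑ x, c S x • Ω x), ← h1]
  simp only [← chain_sub_chain_mul hP hQ h.sign_ne_zero hH, hS.neg_one_pow, one_mul, sub_smul,
    sum_sub_distrib, ← hc, h1]
  abel

/-- The even relation: for a nonempty set `S` of even size, the sum of `Ω` over a product of half
systems supported on `S` is a combination of values of `Ω` with smaller support. -/
theorem sum_half_mem (h : IsSignedDistribution j A B Ω) (hV : ∀ v : V, v + v = 0 → v = 0)
    {H : ∀ i, Finset (K i)} (hH : ∀ i x, x ≠ 0 → (j i * x ∈ H i ↔ x ∉ H i))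
    {S : Finset ι} (hS : Even #S) {T : AddSubgroup V} (hT : ∀ x, supp x ⊂ S → Ω x ∈ T) :
    ∑ x with supp x = S ∧ ∀ i ∈ S, x i ∈ H i, Ω x ∈ T := by
  have hP : ∀ i l, (fun i => (A i)⁻¹) i l ≠ 0 := fun i l => by simp [h.ne_zero_left i l]
  have hQ : ∀ i l, (fun i => (B i)⁻¹) i l ≠ 0 := fun i l => by simp [h.ne_zero_right i l]
  -- The top part of a chain is an alternating pattern. Complementing every second half system,
  -- counted from the end of `S`, turns it into the indicator of the product of the `H i`.
  set H' : ∀ i, Finset (K i) := fun i => if Even #{l ∈ S | i < l} then H i else (H i)ᶜ with hH'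
  have hH'' : ∀ i x, x ≠ 0 → (j i * x ∈ H' i ↔ x ∉ H' i) := by
    intro i x hx
    simp only [hH']
    split_ifs
    · exact hH i x hx
    · simp [hH i x hx]
  have h0 := h.sum_chain hV hH'' hS
  rw [← sum_filter_add_sum_filter_not univ (fun x : ∀ i, K i => supp x = S)] at h0
  have h1 : ∑ x with supp x = S, chain (fun i => (A i)⁻¹) (fun i => (B i)⁻¹) H' S x • Ω x =
      ∑ x with supp x = S ∧ ∀ i ∈ S, x i ∈ H i, Ω x := by
    rw [← filter_filter, sum_filter (p := fun x : ∀ i, K i => ∀ i ∈ S, x i ∈ H i)]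
    refine sum_congr rfl fun x hx => ?_
    rw [chain_top S (by simpa using hx), alternating]
    have : ∀ i, (decide (x i ∈ H' i) = decide (Even #{l ∈ S | i < l})) ↔ x i ∈ H i := by
      intro i
      by_cases he : Even #{l ∈ S | i < l} <;> simp [hH', he]
    simp only [this]
    rw [prod_ite_zero]
    split_ifs <;> simp
  rw [h1] at h0
  rw [eq_neg_of_add_eq_zero_left h0]
  refine T.neg_mem (T.sum_mem fun x hx => ?_)
  by_cases hc : chain (fun i => (A i)⁻¹) (fun i => (B i)⁻¹) H' S x = 0
  · simp [hc, T.zero_mem]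
  · exact T.zsmul_mem (hT x ((chain_support hP hQ S hc).ssubset_of_ne (by simpa using hx))) _

end IsSignedDistribution

/-- The abstract form of Kučera's set: tuples `x` avoiding the values `j i`, whose last coordinate
different from `0` and `1` lies in the half system, and with support of odd size if there is no
such coordinate. -/
def kuceraSet (j : ∀ i, K i) (H : ∀ i, Finset (K i)) : Set (∀ i, K i) :=
  {x | (∀ i, x i ≠ 0 → x i ≠ j i) ∧
    (∀ k, x k ≠ 0 → x k ≠ 1 → (∀ i, k < i → x i ≠ 0 → x i = 1) → x k ∈ H k) ∧
    ((∀ i, x i ≠ 0 → x i = 1) → Odd #(supp x))}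

theorem exists_last_ne_one {x : ∀ i, K i} (hx : ¬ ∀ i, x i ≠ 0 → x i = 1) :
    ∃ k, (x k ≠ 0 ∧ x k ≠ 1) ∧ ∀ i, k < i → x i ≠ 0 → x i = 1 := by
  push Not at hx
  obtain ⟨i, hi⟩ := hx
  have hne : (univ.filter fun k => x k ≠ 0 ∧ x k ≠ 1).Nonempty := ⟨i, by simpa using hi⟩
  refine ⟨_, by simpa using max'_mem _ hne, fun l hl hl0 => ?_⟩
  by_contra h1
  exact absurd (le_max' (univ.filter fun k => x k ≠ 0 ∧ x k ≠ 1) l (by simp [hl0, h1]))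
    (not_le.2 hl)

namespace IsSignedDistribution

variable {j : ∀ i, K i} {A B : ι → ∀ i, K i} {Ω : (∀ i, K i) → V}

/-- The norm relation at a coordinate equal to the sign trades it for all other nonzero values,
modulo smaller support. The number of such coordinates drops, and the remaining coordinates are
untouched. -/
theorem mem_of_expand (h : IsSignedDistribution j A B Ω) {S : Finset ι} {T : AddSubgroup V}
    (hT : ∀ x, supp x ⊂ S → Ω x ∈ T) {x : ∀ i, K i} (hx : supp x = S)
    (hz : ∀ z, supp z = S → (∀ i, z i ≠ j i) → (∀ i, x i ≠ j i → z i = x i) → Ω z ∈ T) :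
    Ω x ∈ T := by
  induction hn : #{i | x i = j i} using Nat.strong_induction_on generalizing x with
  | _ n ih =>
    subst hn
    by_cases hx' : ∀ i, x i ≠ j i
    · exact hz x hx hx' fun _ _ => rfl
    push Not at hx'
    obtain ⟨i, hi⟩ := hx'
    have hxi : x i ≠ 0 := hi ▸ h.sign_ne_zero i
    have hiS : i ∈ S := by rw [← hx]; simpa using hxi
    have hlow : supp (Function.update x i 0) ⊂ S := by
      rw [supp_update_zero, hx]; exact erase_ssubset hiS
    have hn := h.norm i (Function.update x i 0) (by simp)
    simp only [Function.update_idem] at hn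
    rw [← add_sum_erase (a := x i) _ _ (by simpa using hxi), Function.update_eq_self] at hn
    rw [eq_sub_of_add_eq hn]
    refine T.sub_mem (T.sub_mem (hT _ ?_) (hT _ ?_)) (T.sum_mem fun g hg => ?_)
    · rwa [supp_mul (h.ne_zero_left i)]
    · rwa [supp_mul (h.ne_zero_right i)]
    have hg : g ≠ x i ∧ g ≠ 0 := by simpa using hg
    refine ih _ (card_lt_card ?_) (x := Function.update x i g) ?_ ?_ rfl
    · refine ssubset_of_subset_of_ne (fun l hl => ?_) fun he => ?_
      · by_cases hli : l = i
        · subst hli; simpa using hi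
        · simpa [hli] using hl
      · have : i ∈ ({l | x l = j l} : Finset ι) := by simpa using hi
        rw [← he] at this
        exact hg.1 (by simpa [← hi] using this)
    · rw [supp_update_of_ne_zero hg.2, hx, insert_eq_of_mem hiS]
    · intro z hzS hzj hzx
      refine hz z hzS hzj fun l hl => ?_
      have hli : l ≠ i := by rintro rfl; exact hl hi
      rw [hzx l (by simpa [hli] using hl), Function.update_of_ne hli]

/-- Every value of a signed distribution is an integral combination of the values on
`kuceraSet`. -/
theorem mem_of_kuceraSet (h : IsSignedDistribution j A B Ω) (hV : ∀ v : V, v + v = 0 → v = 0)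
    {H : ∀ i, Finset (K i)} (hH : ∀ i x, x ≠ 0 → (j i * x ∈ H i ↔ x ∉ H i))
    (hH1 : ∀ i, 1 ∈ H i) {T : AddSubgroup V} (hT : ∀ x ∈ kuceraSet j H, Ω x ∈ T)
    (x : ∀ i, K i) : Ω x ∈ T := by
  induction hS : supp x using Finset.strongInduction generalizing x with
  | H S ih =>
    have hlow : ∀ z, supp z ⊂ S → Ω z ∈ T := fun z hz => ih _ hz z rfl
    have hjH : ∀ i, j i ∉ H i := fun i => by
      have := (hH i 1 one_ne_zero).not.2 (not_not.2 (hH1 i))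
      rwa [mul_one] at this
    have hjj : ∀ i, j i * j i = 1 := fun i => congrFun h.sign_mul_self i
    have hj1 : ∀ i, j i ≠ 1 := fun i hi => hjH i (hi ▸ hH1 i)
    -- For even support, `z` is one term of the even relation. The other terms have all nonzero
    -- coordinates in the half systems and not all equal to 1, so they belong to `kuceraSet`.
    have hone : ∀ z, supp z = S → (∀ i, z i ≠ 0 → z i = 1) → Ω z ∈ T := by
      intro z hzS hz
      rcases (#S).even_or_odd with he | ho
      · have := h.sum_half_mem hV hH he hlow
        rw [← add_sum_erase (a := z)] at this
        · refine (T.add_mem_cancel_right (T.sum_mem fun y hy => hT y ?_)).1 this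
          simp only [mem_erase, mem_filter, mem_univ, true_and] at hy
          obtain ⟨hyz, hyS, hyH⟩ := hy
          have hyH' : ∀ i, y i ≠ 0 → y i ∈ H i := fun i hi => hyH i (by rw [← hyS]; simpa using hi)
          refine ⟨fun i hi h' => hjH i (h' ▸ hyH' i hi), fun k hk _ _ => hyH' k hk, fun h1 => ?_⟩
          refine absurd ?_ hyz
          ext i
          by_cases hi : i ∈ S
          · rw [h1 i (by rwa [← mem_supp, hyS]), hz i (by rwa [← mem_supp, hzS])]
          · have h1 : y i = 0 := by rwa [← hyS, mem_supp, not_not] at hi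
            have h2 : z i = 0 := by rwa [← hzS, mem_supp, not_not] at hi
            rw [h1, h2]
        · simp only [mem_filter, mem_univ, true_and]
          refine ⟨hzS, fun i hi => ?_⟩
          rw [hz i (by rwa [← mem_supp, hzS])]
          exact hH1 i
      · refine hT z ⟨fun i hi h' => hj1 i (h' ▸ hz i hi), fun k hk hk1 => absurd (hz k hk) hk1,
          fun _ => hzS ▸ ho⟩
    -- Downward induction on `k`. If `z k ∉ H k`, pass to `j * z`: coordinate `k` enters `H k` and
    -- stays different from 1 and the sign. Coordinates that were 1 become signs, and expanding them
    -- can only move the last nontrivial coordinate beyond `k`, which the induction covers.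
    have hmain : ∀ k : ι, ∀ z, supp z = S → (∀ i, z i ≠ j i) → z k ≠ 0 → z k ≠ 1 →
        (∀ i, k < i → z i ≠ 0 → z i = 1) → Ω z ∈ T := by
      intro k
      induction k using WellFoundedGT.induction with
      | ind k ihk =>
        have hgood : ∀ z, supp z = S → (∀ i, z i ≠ j i) → z k ≠ 0 → z k ≠ 1 → z k ∈ H k →
            Ω z ∈ T := by
          intro z hzS hzj hzk hzk1 hzH
          obtain ⟨l, ⟨hl0, hl1⟩, hl⟩ := exists_last_ne_one (x := z) fun h' => hzk1 (h' k hzk)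
          rcases lt_trichotomy k l with hkl | rfl | hkl
          · exact ihk l hkl z hzS hzj hl0 hl1 hl
          · refine hT z ⟨fun i _ => hzj i, fun k' hk'0 hk'1 hk' => ?_,
            fun h' => absurd (h' k hzk) hzk1⟩
            rcases lt_trichotomy k k' with hlt | rfl | hlt
            · exact absurd (hl k' hlt hk'0) hk'1
            · exact hzH
            · exact absurd (hk' k hlt hzk) hzk1
          · exact absurd (hl k hkl hzk) hzk1
        intro z hzS hzj hzk hzk1 hz
        by_cases hzH : z k ∈ H k
        · exact hgood z hzS hzj hzk hzk1 hzH
        · have hodd := h.odd z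
          rw [← T.neg_mem_iff, ← hodd]
          refine h.mem_of_expand hlow (x := j * z) (by rw [supp_mul h.sign_ne_zero, hzS]) ?_
          intro y hyS hyj hy
          have hyk : y k = j k * z k := hy k fun h' => hzk1 (by
            have := congrArg (j k * ·) h'
            simpa [← mul_assoc, hjj] using this)
          refine hgood y hyS hyj ?_ ?_ ?_
          · rw [hyk]; exact mul_ne_zero (h.sign_ne_zero k) hzk
          · intro h1
            rw [hyk] at h1
            have := congrArg (j k * ·) h1
            exact hzj k (by simpa [← mul_assoc, hjj] using this)
          · rw [hyk, hH k _ hzk]; exact hzH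
    refine h.mem_of_expand hlow hS fun z hzS hzj _ => ?_
    by_cases hz : ∀ i, z i ≠ 0 → z i = 1
    · exact hone z hzS hz
    · obtain ⟨k, ⟨hk0, hk1⟩, hk⟩ := exists_last_ne_one hz
      exact hmain k z hzS hzj hk0 hk1 hk

end IsSignedDistribution

end SignedDistribution

/-! ### Counting Kučera's set by an involution. -/

namespace SignedDistribution

variable {ι : Type*} [Fintype ι] [LinearOrder ι] {K : ι → Type*}
  [∀ i, CommGroupWithZero (K i)] [∀ i, DecidableEq (K i)] [∀ i, Fintype (K i)]

theorem last_ne_one_unique {x : ∀ i, K i} {k l : ι} (hk : x k ≠ 0 ∧ x k ≠ 1)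
    (hk' : ∀ i, k < i → x i ≠ 0 → x i = 1) (hl : x l ≠ 0 ∧ x l ≠ 1)
    (hl' : ∀ i, l < i → x i ≠ 0 → x i = 1) : k = l := by
  rcases lt_trichotomy k l with h | h | h
  · exact absurd (hk' l h hl.1) hl.2
  · exact h
  · exact absurd (hl' k h hk.1) hk.2

open Classical in
/-- The involution multiplying the last coordinate different from `0` and `1` by the sign, and
toggling the coordinate `o` between `0` and `1` if there is no such coordinate. -/
noncomputable def flip (j : ∀ i, K i) (o : ι) (x : ∀ i, K i) : ∀ i, K i :=
  if h : ∀ i, x i ≠ 0 → x i = 1 then Function.update x o (if x o = 0 then 1 else 0)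
  else Function.update x (exists_last_ne_one h).choose
    (j _ * x (exists_last_ne_one h).choose)

theorem flip_of_last {j : ∀ i, K i} {o : ι} {x : ∀ i, K i} {k : ι} (hk : x k ≠ 0 ∧ x k ≠ 1)
    (hk' : ∀ i, k < i → x i ≠ 0 → x i = 1) :
    flip j o x = Function.update x k (j k * x k) := by
  have h : ¬ ∀ i, x i ≠ 0 → x i = 1 := fun h => hk.2 (h k hk.1)
  have e := last_ne_one_unique hk hk' (exists_last_ne_one h).choose_spec.1
    (exists_last_ne_one h).choose_spec.2
  rw [flip, dif_neg h, ← e]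

theorem flip_of_forall {j : ∀ i, K i} {o : ι} {x : ∀ i, K i} (h : ∀ i, x i ≠ 0 → x i = 1) :
    flip j o x = Function.update x o (if x o = 0 then 1 else 0) := by
  rw [flip, dif_pos h]

section

variable {j : ∀ i, K i} (hj1 : ∀ i, j i ≠ 1) (hjj : j * j = 1)

include hjj in
theorem sign_mul_sign_mul (i : ι) (a : K i) : j i * (j i * a) = a := by
  rw [← mul_assoc, ← Pi.mul_apply, hjj, Pi.one_apply, one_mul]

include hjj in
theorem sign_ne_zero_of_sq (i : ι) : j i ≠ 0 := by
  intro h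
  have := sign_mul_sign_mul hjj i 1
  simp [h] at this

include hj1 hjj in
theorem flip_spec {x : ∀ i, K i} {k : ι} (hxk : x k ≠ j k) (hk : x k ≠ 0 ∧ x k ≠ 1)
    (hk' : ∀ i, k < i → x i ≠ 0 → x i = 1) :
    (j k * x k ≠ j k ∧ j k * x k ≠ 0 ∧ j k * x k ≠ 1) ∧
      ∀ i, k < i → Function.update x k (j k * x k) i ≠ 0 →
        Function.update x k (j k * x k) i = 1 := by
  have h0 := sign_ne_zero_of_sq hjj k
  refine ⟨⟨?_, mul_ne_zero h0 hk.1, ?_⟩, fun i hi => ?_⟩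
  · intro h; exact hk.2 (mul_left_cancel₀ h0 (by rw [h, mul_one]))
  · intro h
    have := congrArg (j k * ·) h
    exact hxk (by simpa [sign_mul_sign_mul hjj] using this)
  · rw [Function.update_of_ne hi.ne']
    exact hk' i hi

theorem forall_update_toggle {x : ∀ i, K i} {o : ι} (h : ∀ i, x i ≠ 0 → x i = 1) (i : ι) :
    Function.update x o (if x o = 0 then 1 else 0) i ≠ 0 →
      Function.update x o (if x o = 0 then 1 else 0) i = 1 := by
  by_cases hi : i = o
  · subst hi
    by_cases h0 : x i = 0 <;> simp [h0]
  · rw [Function.update_of_ne hi]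
    exact h i

include hj1 hjj in
theorem flip_ne_sign {x : ∀ i, K i} {o : ι} (hx : ∀ i, x i ≠ j i) (i : ι) :
    flip j o x i ≠ j i := by
  by_cases h : ∀ i, x i ≠ 0 → x i = 1
  · rw [flip_of_forall h]
    intro hi
    by_cases h0 : j i = 0
    · exact sign_ne_zero_of_sq hjj i h0
    · rw [← hi] at h0
      exact hj1 i (hi ▸ forall_update_toggle h i h0)
  · obtain ⟨k, hk, hk'⟩ := exists_last_ne_one h
    rw [flip_of_last hk hk']
    by_cases hi : i = k
    · subst hi
      simpa using (flip_spec hj1 hjj (hx i) hk hk').1.1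
    · rw [Function.update_of_ne hi]; exact hx i

include hj1 hjj in
theorem flip_flip {x : ∀ i, K i} {o : ι} (hx : ∀ i, x i ≠ j i) : flip j o (flip j o x) = x := by
  by_cases h : ∀ i, x i ≠ 0 → x i = 1
  · rw [flip_of_forall h, flip_of_forall (forall_update_toggle h), Function.update_idem]
    ext i
    by_cases hi : i = o
    · subst hi
      by_cases h0 : x i = 0
      · simp [h0]
      · simp [h i h0]
    · rw [Function.update_of_ne hi]
  · obtain ⟨k, hk, hk'⟩ := exists_last_ne_one h
    obtain ⟨h1, h2⟩ := flip_spec hj1 hjj (hx k) hk hk'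
    rw [flip_of_last hk hk', flip_of_last (k := k) (by simpa using h1.2) h2, Function.update_idem,
      Function.update_self, sign_mul_sign_mul hjj, Function.update_eq_self]

include hj1 hjj in
-- The sign moves the last nontrivial coordinate out of its half system; the toggle between 0 and 1
-- changes the parity of the support.
theorem flip_notMem_kuceraSet {H : ∀ i, Finset (K i)}
    (hH : ∀ i x, x ≠ 0 → (j i * x ∈ H i ↔ x ∉ H i)) {x : ∀ i, K i} {o : ι}
    (hx : ∀ i, x i ≠ j i) (hxM : x ∈ kuceraSet j H) : flip j o x ∉ kuceraSet j H := by
  intro hf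
  by_cases h : ∀ i, x i ≠ 0 → x i = 1
  · rw [flip_of_forall h] at hf
    have h1 := hf.2.2 (forall_update_toggle h)
    have h2 := hxM.2.2 h
    by_cases h0 : x o = 0
    · rw [if_pos h0, supp_update_of_ne_zero one_ne_zero, card_insert_of_notMem (by simpa using h0),
        Nat.odd_add_one] at h1
      exact h1 h2
    · rw [if_neg h0, supp_update_zero] at h1
      rw [← card_erase_add_one (a := o) (by simpa using h0), Nat.odd_add_one] at h2
      exact h2 h1
  · obtain ⟨k, hk, hk'⟩ := exists_last_ne_one h
    obtain ⟨h1, h2⟩ := flip_spec hj1 hjj (hx k) hk hk'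
    rw [flip_of_last hk hk'] at hf
    have h3 := hf.2.1 k (by simpa using h1.2.1) (by simpa using h1.2.2) h2
    rw [Function.update_self, hH k _ hk.1] at h3
    exact h3 (hxM.2.1 k hk.1 hk.2 hk')

include hj1 hjj in
-- The set and its image under `flip` are disjoint and consist of tuples avoiding `j i` at every
-- index. The `- 1` in each factor accounts for the excluded value `j i`; zero is still allowed.
theorem two_mul_ncard_kuceraSet_le [Nonempty ι] {H : ∀ i, Finset (K i)}
    (hH : ∀ i x, x ≠ 0 → (j i * x ∈ H i ↔ x ∉ H i)) :
    2 * (kuceraSet j H).ncard ≤ ∏ i, (Fintype.card (K i) - 1) := by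
  classical
  obtain ⟨o⟩ := ‹Nonempty ι›
  set M : Finset (∀ i, K i) := {x | x ∈ kuceraSet j H} with hM
  have hMN : ∀ x ∈ M, ∀ i, x i ≠ j i := by
    intro x hx i hi
    have hx : x ∈ kuceraSet j H := by simpa [hM] using hx
    exact hx.1 i (hi ▸ sign_ne_zero_of_sq hjj i) hi
  have hinj : Set.InjOn (flip j o) M := by
    intro x hx y hy hxy
    rw [← flip_flip hj1 hjj (o := o) (hMN x hx), hxy, flip_flip hj1 hjj (hMN y hy)]
  have hdisj : Disjoint M (M.image (flip j o)) := by
    rw [Finset.disjoint_left]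
    intro y hy hy'
    obtain ⟨x, hx, rfl⟩ := mem_image.1 hy'
    exact flip_notMem_kuceraSet hj1 hjj hH (hMN x hx) (by simpa [hM] using hx)
      (by simpa [hM] using hy)
  have hsub : M ∪ M.image (flip j o) ⊆ Fintype.piFinset fun i => univ.erase (j i) := by
    intro y hy
    rw [Fintype.mem_piFinset]
    intro i
    rw [mem_erase]
    refine ⟨?_, mem_univ _⟩
    rcases mem_union.1 hy with hy | hy
    · exact hMN y hy i
    · obtain ⟨x, hx, rfl⟩ := mem_image.1 hy
      exact flip_ne_sign hj1 hjj (hMN x hx) i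
  have hcard := card_le_card hsub
  rw [card_union_of_disjoint hdisj, card_image_of_injOn hinj, Fintype.card_piFinset] at hcard
  simp only [card_erase_of_mem (mem_univ _), card_univ] at hcard
  have : (kuceraSet j H).ncard = #M := by
    rw [← Set.ncard_coe_finset]
    simp [hM]
  omega

end

end SignedDistribution

end

/-! ### The odd Hurwitz zeta function at 1 and the nonvanishing of L(1, χ). -/

section

open Filter Topology Complex

/-- Bernoulli's inequality for (b/c)^s. -/
theorem rpow_neg_sub_rpow_neg_le {b c s : ℝ} (hb : 0 < b) (hbc : b ≤ c) (hs : 1 ≤ s) :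
    1 / b ^ s - 1 / c ^ s ≤ s * (c - b) / (b ^ s * c) := by
  have hc : 0 < c := hb.trans_le hbc
  have h := one_add_mul_self_le_rpow_one_add (s := b / c - 1)
    (by have := div_pos hb hc; linarith) hs
  have e : (1 + (b / c - 1)) ^ s = b ^ s / c ^ s := by
    rw [add_sub_cancel, Real.div_rpow hb.le hc.le]
  rw [e] at h
  have hbs : 0 < b ^ s := Real.rpow_pos_of_pos hb s
  have hcs : 0 < c ^ s := Real.rpow_pos_of_pos hc s
  have : 1 / b ^ s - 1 / c ^ s = (1 - b ^ s / c ^ s) / b ^ s := by field_simp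
  rw [this, show s * (c - b) / (b ^ s * c) = (s * (1 - b / c)) / b ^ s by field_simp]
  gcongr
  linarith

theorem abs_rpow_neg_sub_rpow_neg_le {b c d s : ℝ} (hd : 0 < d) (hb : d ≤ b) (hc : d ≤ c)
    (hbc : |b - c| ≤ 1) (hs : 1 ≤ s) (hs2 : s ≤ 2) :
    |1 / b ^ s - 1 / c ^ s| ≤ 2 / (d ^ s * d) := by
  wlog h : b ≤ c generalizing b c
  · rw [abs_sub_comm]
    exact this hc hb (by rwa [abs_sub_comm]) (not_le.1 h).le
  have hb0 := hd.trans_le hb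
  have h1 : 1 / c ^ s ≤ 1 / b ^ s :=
    one_div_le_one_div_of_le (Real.rpow_pos_of_pos hb0 s) (Real.rpow_le_rpow hb0.le h (by linarith))
  rw [abs_of_nonneg (sub_nonneg.2 h1)]
  refine (rpow_neg_sub_rpow_neg_le hb0 h hs).trans ?_
  have h2 : c - b ≤ 1 := by rw [abs_sub_comm, abs_of_nonneg (sub_nonneg.2 h)] at hbc; exact hbc
  have : s * (c - b) ≤ 2 * 1 := by
    apply mul_le_mul hs2 h2 (sub_nonneg.2 h) (by norm_num)
  have hds := Real.rpow_pos_of_pos hd s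
  rw [mul_one] at this
  gcongr

/-- The series is known to represent the function only for s > 1. Let s decrease to 1: the function
is continuous there, and the series converges dominatedly because paired terms decay like n⁻²
uniformly in s ∈ [1, 2]. -/
theorem hurwitzZetaOdd_one_eq_tsum {a : ℝ} (ha : 0 < a) (ha1 : a < 1) :
    Summable (fun n : ℕ => (1 / (n + a) - 1 / (n + 1 - a)) / 2) ∧
    HurwitzZeta.hurwitzZetaOdd a 1 =
      ((∑' n : ℕ, (1 / (n + a) - 1 / (n + 1 - a)) / 2 : ℝ) : ℂ) := by
  -- `n + d` bounds both denominators from below and stays positive at `n = 0`.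
  set d := min a (1 - a) with hd
  have hd0 : 0 < d := lt_min ha (by linarith)
  have hda : d ≤ a := min_le_left _ _
  have hda' : d ≤ 1 - a := min_le_right _ _
  set F : ℝ → ℕ → ℝ := fun s n => (1 / ((n : ℝ) + a) ^ s - 1 / ((n : ℝ) + 1 - a) ^ s) / 2 with hF
  set bound : ℕ → ℝ := fun n => (1 / d) * (1 / |(n : ℝ) + d| ^ (2 : ℝ)) with hbd
  have hsum : Summable bound :=
    ((Real.summable_one_div_nat_add_rpow d 2).2 (by norm_num)).mul_left _
  have hle : ∀ s : ℝ, 1 ≤ s → s ≤ 2 → ∀ n, ‖F s n‖ ≤ bound n := by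
    intro s hs hs2 n
    have hn : (0 : ℝ) ≤ n := Nat.cast_nonneg n
    have hnd : 0 < (n : ℝ) + d := by linarith
    have h1 := abs_rpow_neg_sub_rpow_neg_le (b := n + a) (c := n + 1 - a) (d := n + d) (s := s)
      hnd (by linarith) (by linarith) (by rw [abs_le]; constructor <;> linarith) hs hs2
    rw [hF, Real.norm_eq_abs, abs_div, abs_two, hbd]
    simp only
    rw [abs_of_pos hnd]
    have h2 : d * ((n : ℝ) + d) ^ (2 : ℝ) ≤ ((n : ℝ) + d) ^ s * (n + d) := by
      have e1 : ((n : ℝ) + d) ^ s * (n + d) = ((n : ℝ) + d) ^ (s - 1) * (n + d) ^ (2 : ℝ) := by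
        rw [← Real.rpow_add_one hnd.ne', ← Real.rpow_add hnd]
        congr 1; ring
      rw [e1]
      gcongr
      calc d = d ^ (1 : ℝ) := (Real.rpow_one d).symm
        _ ≤ d ^ (s - 1) := Real.rpow_le_rpow_of_exponent_ge hd0 (by linarith) (by linarith)
        _ ≤ _ := Real.rpow_le_rpow hd0.le (by linarith) (by linarith)
    have h3 : 0 < d * ((n : ℝ) + d) ^ (2 : ℝ) := mul_pos hd0 (Real.rpow_pos_of_pos hnd _)
    rw [div_le_iff₀ two_pos]
    refine h1.trans ?_
    rw [one_div_mul_one_div, div_mul_eq_mul_div, one_mul]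
    gcongr
  have hT : Tendsto (fun s => ∑' n, F s n) (𝓝[>] 1) (𝓝 (∑' n, F 1 n)) := by
    refine tendsto_tsum_of_dominated_convergence hsum (fun n => ?_) ?_
    · have hn : (0 : ℝ) ≤ n := Nat.cast_nonneg n
      have h1 : (0 : ℝ) < n + a := by linarith
      have h2 : (0 : ℝ) < n + 1 - a := by linarith
      have : ContinuousAt (fun s : ℝ => F s n) 1 := by
        simp only [hF]
        have c1 : ContinuousAt (fun s : ℝ => ((n : ℝ) + a) ^ s) 1 :=
          Real.continuousAt_const_rpow h1.ne'
        have c2 : ContinuousAt (fun s : ℝ => ((n : ℝ) + 1 - a) ^ s) 1 :=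
          Real.continuousAt_const_rpow h2.ne'
        exact ((continuousAt_const.div c1 (Real.rpow_pos_of_pos h1 _).ne').sub
          (continuousAt_const.div c2 (Real.rpow_pos_of_pos h2 _).ne')).div_const 2
      exact this.tendsto.mono_left nhdsWithin_le_nhds
    · have : ∀ᶠ s : ℝ in 𝓝[>] 1, s < 2 :=
        (eventually_lt_nhds (by norm_num)).filter_mono nhdsWithin_le_nhds
      filter_upwards [this, self_mem_nhdsWithin] with s hs2 hs1
      exact hle s (le_of_lt hs1) hs2.le
  have hF1 : F 1 = fun n : ℕ => (1 / (n + a) - 1 / (n + 1 - a)) / 2 := by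
    ext n; simp [hF]
  refine ⟨hF1 ▸ (hsum.of_norm_bounded (hle 1 le_rfl (by norm_num))), ?_⟩
  have hZ : Tendsto (fun s : ℝ => HurwitzZeta.hurwitzZetaOdd a (s : ℂ)) (𝓝[>] 1)
      (𝓝 (HurwitzZeta.hurwitzZetaOdd a 1)) := by
    have h1 := (HurwitzZeta.differentiable_hurwitzZetaOdd (a : UnitAddCircle)).continuous
    have h2 := (h1.comp Complex.continuous_ofReal).tendsto 1
    simp only [Function.comp_def, ofReal_one] at h2
    exact h2.mono_left nhdsWithin_le_nhds
  refine tendsto_nhds_unique hZ ?_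
  have hT' := (Complex.continuous_ofReal.tendsto _).comp hT
  rw [hF1] at hT'
  refine hT'.congr' ?_
  filter_upwards [self_mem_nhdsWithin] with s hs
  have h := HurwitzZeta.hasSum_nat_hurwitzZetaOdd_of_mem_Icc (a := a) ⟨ha.le, ha1.le⟩
    (s := s) (by simpa using hs)
  rw [← h.tsum_eq, Function.comp_apply, ofReal_tsum]
  refine tsum_congr fun n => ?_
  have hn : (0 : ℝ) ≤ n := Nat.cast_nonneg n
  simp only [hF]
  push_cast
  rw [ofReal_cpow (by linarith), ofReal_cpow (by linarith)]
  push_cast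
  rfl

theorem hurwitzZetaOdd_one {a : ℝ} (ha : 0 < a) (ha1 : a < 1) :
    HurwitzZeta.hurwitzZetaOdd a 1 = Real.pi / 2 * Complex.cot (Real.pi * a) := by
  obtain ⟨hs, he⟩ := hurwitzZetaOdd_one_eq_tsum ha ha1
  have hz : (a : ℂ) ∈ Complex.integerComplement := by
    rw [Complex.mem_integerComplement_iff]
    rintro ⟨n, hn⟩
    have hn : (n : ℝ) = a := by exact_mod_cast hn
    rw [← hn] at ha ha1
    have h1 : 0 < n := by exact_mod_cast ha
    have h2 : n < 1 := by exact_mod_cast ha1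
    omega
  rw [he]
  have h1 := ((hs.hasSum.tendsto_sum_nat).const_mul 2)
  have h2 := (Complex.continuous_ofReal.tendsto _).comp h1
  have h3 := ((summable_cotTerm hz).hasSum.tendsto_sum_nat).add_const (1 / (a : ℂ))
  -- The partial sums differ from those of the Mittag-Leffler series of the cotangent by the
  -- boundary term 1/(a + N).
  have h4 : Tendsto (fun n : ℕ => 1 / ((a : ℂ) + n)) atTop (𝓝 0) := by
    have : Tendsto (fun n : ℕ => 1 / (a + (n : ℝ))) atTop (𝓝 0) :=
      (tendsto_const_nhds.div_atTop
        (tendsto_atTop_add_const_left _ _ tendsto_natCast_atTop_atTop))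
    have := (Complex.continuous_ofReal.tendsto _).comp this
    simpa [Function.comp_def] using this
  have h5 := h3.sub h4
  have h6 := cot_series_rep' hz
  simp only [cotTerm] at h5
  rw [← h6] at h5
  have h7 := tendsto_nhds_unique h2 (h5.congr fun N => ?_)
  · rw [ofReal_mul, ofReal_ofNat] at h7
    linear_combination h7 / 2
  · have ha0 : (a : ℂ) ≠ 0 := by exact_mod_cast ha.ne'
    simp only [Function.comp_apply]
    push_cast
    induction N with
    | zero => simp
    | succ N ih =>
      have hne : (a : ℂ) - (N + 1) ≠ 0 := by
        simpa [sub_eq_add_neg] using integerComplement_add_ne_zero hz (-(N + 1) : ℤ)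
      have hne' : (N : ℂ) + 1 - a ≠ 0 := by
        intro h; exact hne (by linear_combination -h)
      have e : 1 / ((N : ℂ) + 1 - a) = -(1 / ((a : ℂ) - (N + 1))) := by
        rw [show (a : ℂ) - (N + 1) = -((N : ℂ) + 1 - a) by ring, one_div_neg_eq_neg_one_div,
          neg_neg]
      rw [Finset.sum_range_succ, Finset.sum_range_succ, mul_add, ← ih]
      push_cast
      rw [e, add_comm (N : ℂ) (a : ℂ)]
      ring

/-- Up to the factor π/(2m) the sum is L(1, χ), and an odd character is nontrivial. -/
theorem DirichletCharacter.Odd.sum_mul_cot_ne_zero {m : ℕ} [NeZero m] {χ : DirichletCharacter ℂ m}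
    (hχ : χ.Odd) : ∑ j : ZMod m, χ j * Complex.cot (Real.pi * (j.val / m)) ≠ 0 := by
  have hχ1 : χ ≠ 1 := by
    rintro rfl
    have : (1 : DirichletCharacter ℂ m) (-1) = -1 := hχ
    rw [MulChar.one_apply (isUnit_one.neg)] at this
    norm_num at this
  have h := χ.LFunction_apply_one_ne_zero hχ1
  rw [DirichletCharacter.LFunction, ZMod.LFunction_def_odd hχ.to_fun] at h
  intro h0
  refine h ?_
  have : ∀ j : ZMod m, HurwitzZeta.hurwitzZetaOdd (ZMod.toAddCircle j) 1 =
      Real.pi / 2 * Complex.cot (Real.pi * (j.val / m)) := by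
    intro j
    -- At 0 the odd zeta function vanishes by oddness, and `Complex.cot 0 = 0` by the convention for
    -- division by zero.
    by_cases hj : j = 0
    · subst hj
      have := HurwitzZeta.hurwitzZetaOdd_neg 0 1
      rw [neg_zero, self_eq_neg] at this
      simp [this, Complex.cot]
    · have hm : (0 : ℝ) < m := Nat.cast_pos.2 (NeZero.pos m)
      have hv : (0 : ℝ) < j.val := Nat.cast_pos.2 (Nat.pos_of_ne_zero (by simpa using hj))
      have hv' : (j.val : ℝ) < m := Nat.cast_lt.2 (ZMod.val_lt j)
      rw [ZMod.toAddCircle_apply, hurwitzZetaOdd_one (by positivity) ((div_lt_one hm).2 hv')]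
      push_cast
      rfl
  simp only [this]
  rw [Finset.sum_congr rfl fun j _ => mul_left_comm _ _ _, ← Finset.mul_sum, h0]
  simp

end

/-! ### The sawtooth function: distribution relation, Fourier transform, odd characters. -/

section

open Finset

/-- The sawtooth function `x ↦ ⟨x⟩ - ½`, with value `0` at the integers. -/
def sawtooth (x : ℚ) : ℚ := if Int.fract x = 0 then 0 else Int.fract x - 1 / 2

/-- The sawtooth function on `ZMod m`, `x ↦ sawtooth (x / m)`. -/
def saw (m : ℕ) (x : ZMod m) : ℚ := sawtooth (x.val / m)

theorem fract_intCast_div (m : ℕ) [NeZero m] (z : ℤ) :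
    Int.fract ((z : ℚ) / m) = ((z : ZMod m).val : ℚ) / m := by
  have h : (((z : ZMod m).val : ℤ)) = z % m := ZMod.val_intCast z
  have hm : (0 : ℚ) < m := Nat.cast_pos.2 (NeZero.pos m)
  rw [Int.fract_eq_iff]
  refine ⟨by positivity, (div_lt_one hm).2 (Nat.cast_lt.2 (ZMod.val_lt _)), z / m, ?_⟩
  have h2 : (((z : ZMod m).val : ℚ)) = ((z % m : ℤ) : ℚ) := by rw [← h]; simp
  rw [h2, ← sub_div, div_eq_iff hm.ne']
  have := Int.emod_add_mul_ediv z m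
  have h3 : (z : ℚ) = ((z % m : ℤ) : ℚ) + m * ((z / m : ℤ) : ℚ) := by exact_mod_cast this.symm
  linear_combination h3

theorem fract_val_div {m : ℕ} [NeZero m] (x : ZMod m) :
    Int.fract ((x.val : ℚ) / m) = (x.val : ℚ) / m := by
  have := fract_intCast_div m x.val
  simpa using this

theorem saw_intCast (m : ℕ) [NeZero m] (z : ℤ) : saw m z = sawtooth (z / m) := by
  unfold saw sawtooth
  rw [fract_val_div, fract_intCast_div]

theorem saw_eq {m : ℕ} [NeZero m] (x : ZMod m) :
    saw m x = if x.val = 0 then 0 else (x.val : ℚ) / m - 1 / 2 := by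
  have hm : (m : ℚ) ≠ 0 := Nat.cast_ne_zero.2 (NeZero.ne m)
  unfold saw sawtooth
  rw [fract_val_div]
  by_cases h : x.val = 0
  · simp [h]
  · rw [if_neg h, if_neg (div_ne_zero (Nat.cast_ne_zero.2 h) hm)]

@[simp] theorem saw_zero (m : ℕ) [NeZero m] : saw m 0 = 0 := by simp [saw_eq]

theorem saw_neg {m : ℕ} [NeZero m] (x : ZMod m) : saw m (-x) = -saw m x := by
  have hm : (m : ℚ) ≠ 0 := Nat.cast_ne_zero.2 (NeZero.ne m)
  by_cases hx : x = 0
  · simp [hx]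
  · rw [saw_eq, saw_eq, if_neg ((ZMod.val_ne_zero _).2 hx),
      if_neg ((ZMod.val_ne_zero _).2 (neg_ne_zero.2 hx)), ZMod.neg_val, if_neg hx,
      Nat.cast_sub (ZMod.val_lt x).le]
    field_simp
    ring

theorem saw_mul_intCast {m N d : ℕ} [NeZero m] [NeZero d] (h : m = N * d) (z : ℤ) :
    saw m ((N * z : ℤ) : ZMod m) = saw d z := by
  have hN : (N : ℚ) ≠ 0 := by
    rintro h0
    have : N = 0 := by exact_mod_cast h0
    exact NeZero.ne m (by rw [h, this, zero_mul])
  have hd : (d : ℚ) ≠ 0 := Nat.cast_ne_zero.2 (NeZero.ne d)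
  rw [saw_intCast, saw_intCast, h]
  congr 1
  push_cast
  field_simp

theorem natCast_mul_eq_iff {m N d : ℕ} [NeZero m] (h : m = N * d) (x y : ZMod m) :
    (N : ZMod m) * x = N * y ↔ x.val % d = y.val % d := by
  have hN : 0 < N := by
    rcases Nat.eq_zero_or_pos N with h0 | h0
    · exact absurd (by rw [h, h0, zero_mul]) (NeZero.ne m)
    · exact h0
  have hx : (N : ZMod m) * x = ((N * x.val : ℕ) : ZMod m) := by simp
  have hy : (N : ZMod m) * y = ((N * y.val : ℕ) : ZMod m) := by simp
  have h' : ∀ k, k % m = k % (N * d) := fun k => by rw [← h]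
  rw [hx, hy, ZMod.natCast_eq_natCast_iff, Nat.ModEq, h', h', Nat.mul_mod_mul_left,
    Nat.mul_mod_mul_left, Nat.mul_right_inj hN.ne']

/-- The distribution relation. -/
theorem sum_saw {m N : ℕ} [NeZero m] (h : N ∣ m) (a : ZMod m) :
    ∑ b : ZMod m with (N : ZMod m) * b = N * a, saw m b = saw m (N * a) := by
  obtain ⟨d, hd⟩ := h
  have hNd : 0 < N * d := hd ▸ NeZero.pos m
  have hN : 0 < N := Nat.pos_of_mul_pos_right hNd
  have hd0 : 0 < d := Nat.pos_of_mul_pos_left hNd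
  have : NeZero d := ⟨hd0.ne'⟩
  have hNq : (N : ℚ) ≠ 0 := Nat.cast_ne_zero.2 hN.ne'
  have hdq : (d : ℚ) ≠ 0 := Nat.cast_ne_zero.2 hd0.ne'
  set r := a.val % d with hr
  have hrd : r < d := Nat.mod_lt _ hd0
  -- The solutions `b` are the residues r + dk with 0 ≤ k < N.
  have hlt : ∀ k < N, r + d * k < m := by
    intro k hk
    calc r + d * k < d + d * k := by omega
      _ = d * (k + 1) := by ring
      _ ≤ d * N := Nat.mul_le_mul_left _ hk
      _ = m := by rw [hd, mul_comm]
  have hval : ∀ k < N, ((r + d * k : ℕ) : ZMod m).val = r + d * k := fun k hk =>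
    ZMod.val_cast_of_lt (hlt k hk)
  have hsum : ∑ b : ZMod m with (N : ZMod m) * b = N * a, saw m b =
      ∑ k ∈ range N, saw m ((r + d * k : ℕ) : ZMod m) := by
    refine sum_bij' (fun b _ => b.val / d) (fun k _ => ((r + d * k : ℕ) : ZMod m)) ?_ ?_ ?_ ?_ ?_
    · intro b _
      rw [mem_range, Nat.div_lt_iff_lt_mul hd0, ← hd]
      exact ZMod.val_lt b
    · intro k hk
      have hk := mem_range.1 hk
      simp only [mem_filter, mem_univ, true_and]
      rw [natCast_mul_eq_iff hd, hval k hk, Nat.add_mul_mod_self_left, hr, Nat.mod_mod]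
    · intro b hb
      have hb := (natCast_mul_eq_iff hd _ _).1 (mem_filter.1 hb).2
      rw [hr, ← hb, Nat.mod_add_div, ZMod.natCast_zmod_val]
    · intro k hk
      have hk := mem_range.1 hk
      rw [hval k hk, Nat.add_mul_div_left _ _ hd0, Nat.div_eq_of_lt hrd, zero_add]
    · intro b hb
      have hb := (natCast_mul_eq_iff hd _ _).1 (mem_filter.1 hb).2
      rw [hr, ← hb, Nat.mod_add_div, ZMod.natCast_zmod_val]
  have hR : saw m (N * a) = if r = 0 then 0 else (r : ℚ) / d - 1 / 2 := by
    have e : (N : ZMod m) * a = ((N * (a.val : ℤ) : ℤ) : ZMod m) := by simp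
    rw [e, saw_mul_intCast hd, saw_eq]
    have : (((a.val : ℤ) : ZMod d)).val = r := by
      rw [Int.cast_natCast, ZMod.val_natCast]
    rw [this]
  -- The values are affine in `k`, except that the residue 0 has value 0 instead of -½; this
  -- accounts for the correction at `k = 0`, `r = 0`.
  have hterm : ∀ k ∈ range N, saw m ((r + d * k : ℕ) : ZMod m) =
      ((r : ℚ) / (N * d) - 1 / 2 + k / N) + if k = 0 then (if r = 0 then 1 / 2 else 0) else 0 := by
    intro k hk
    have hk := mem_range.1 hk
    rw [saw_eq, hval k hk, show (m : ℚ) = N * d by rw [hd]; push_cast; rfl]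
    by_cases h0 : k = 0
    · subst h0
      by_cases hr0 : r = 0
      · simp [hr0]
      · simp [hr0]
    · rw [if_neg (by positivity), if_neg h0]
      push_cast
      field_simp
      ring
  have hgauss : ∑ k ∈ range N, (k : ℚ) = N * (N - 1) / 2 := by
    clear hsum hterm hval hlt hR hr hd hNd hNq
    induction N with
    | zero => simp
    | succ n ih =>
      rcases Nat.eq_zero_or_pos n with rfl | hn
      · simp
      · rw [sum_range_succ, ih hn]; push_cast; ring
  rw [hsum, hR, sum_congr rfl hterm, sum_add_distrib, sum_add_distrib, sum_const, card_range,
    ← sum_div, hgauss, sum_ite_eq', if_pos (mem_range.2 hN), nsmul_eq_mul]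
  split_ifs with hr0
  · rw [hr0]; push_cast; field_simp; ring
  · field_simp; ring

theorem ZMod.sum_eq_sum_range {M : Type*} [AddCommMonoid M] {m : ℕ} [NeZero m] (f : ZMod m → M) :
    ∑ x, f x = ∑ k ∈ range m, f k :=
  sum_bij' (fun x _ => x.val) (fun k _ => (k : ZMod m)) (fun x _ => mem_range.2 (ZMod.val_lt x))
    (by simp) (by simp) (fun k hk => ZMod.val_cast_of_lt (mem_range.1 hk)) (by simp)

theorem sub_one_mul_sum_mul_pow (z : ℂ) (n : ℕ) :
    (z - 1) * ∑ k ∈ range n, (k : ℂ) * z ^ k = n * z ^ n - z * ∑ k ∈ range n, z ^ k := by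
  induction n with
  | zero => simp
  | succ n ih => rw [sum_range_succ, sum_range_succ, mul_add, ih]; push_cast; ring

/-- The finite Fourier transform of the sawtooth function. -/
theorem sum_saw_mul_stdAddChar {m : ℕ} [NeZero m] (j : ZMod m) :
    ∑ k : ZMod m, (saw m k : ℂ) * ZMod.stdAddChar (j * k) =
      -(Complex.I / 2) * Complex.cot (Real.pi * (j.val / m)) := by
  have hm : (m : ℂ) ≠ 0 := Nat.cast_ne_zero.2 (NeZero.ne m)
  by_cases hj : j = 0
  · subst hj
    have h : ∑ k : ZMod m, (saw m k : ℂ) = -∑ k : ZMod m, (saw m k : ℂ) := by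
      rw [← sum_neg_distrib]
      refine Fintype.sum_equiv (.neg _) _ _ fun k => ?_
      simp [saw_neg]
    simp [self_eq_neg.1 h, Complex.cot]
  set z : ℂ := ZMod.stdAddChar j with hz
  have hz1 : z ≠ 1 := by
    rw [hz, ← AddChar.map_zero_eq_one (ZMod.stdAddChar (N := m))]
    exact fun h => hj (ZMod.injective_stdAddChar h)
  have hpow : ∀ k : ℕ, ZMod.stdAddChar (j * (k : ZMod m)) = z ^ k := by
    intro k
    rw [hz, ← AddChar.map_nsmul_eq_pow, nsmul_eq_mul, mul_comm]
  have hzm : z ^ m = 1 := by rw [← hpow]; simp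
  have hgeom : ∑ k ∈ range m, z ^ k = 0 := by
    have := geom_sum_mul z m
    rw [hzm, sub_self] at this
    exact (mul_eq_zero.1 this).resolve_right (sub_ne_zero.2 hz1)
  have hlin : ∑ k ∈ range m, (k : ℂ) * z ^ k = m / (z - 1) := by
    rw [eq_div_iff (sub_ne_zero.2 hz1), mul_comm, sub_one_mul_sum_mul_pow, hzm, hgeom]
    ring
  have hsaw : ∀ k ∈ range m, (saw m (k : ZMod m) : ℂ) * ZMod.stdAddChar (j * (k : ZMod m)) =
      ((k : ℂ) * z ^ k / m - 1 / 2 * z ^ k) + if k = 0 then 1 / 2 else 0 := by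
    intro k hk
    have hk := mem_range.1 hk
    rw [hpow, saw_eq, ZMod.val_cast_of_lt hk]
    by_cases h0 : k = 0
    · simp [h0]
    · simp only [h0, if_false]; push_cast; ring
  rw [ZMod.sum_eq_sum_range, sum_congr rfl hsaw, sum_add_distrib, sum_sub_distrib, ← sum_div, hlin,
    ← mul_sum, hgeom, sum_ite_eq', if_pos (mem_range.2 (NeZero.pos m)),
    Complex.cot_pi_eq_exp_ratio]
  have hexp : Complex.exp (2 * Real.pi * Complex.I * (j.val / m)) = z := by
    have := ZMod.stdAddChar_coe (N := m) (j.val : ℤ)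
    rw [Int.cast_natCast, ZMod.natCast_zmod_val] at this
    rw [hz, this]
    congr 1
    push_cast
    ring
  rw [hexp]
  have h1 : z - 1 ≠ 0 := sub_ne_zero.2 hz1
  have h2 : 1 - z ≠ 0 := sub_ne_zero.2 hz1.symm
  field_simp
  ring

/-- The sawtooth functions span all odd characters. -/
theorem DirichletCharacter.Odd.mem_span_saw {m : ℕ} [NeZero m] {χ : DirichletCharacter ℂ m}
    (hχ : χ.Odd) : (fun u : (ZMod m)ˣ => χ u) ∈
      Submodule.span ℂ (Set.range fun (a : ZMod m) (u : (ZMod m)ˣ) => (saw m (a * u) : ℂ)) := by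
  set D := Submodule.span ℂ
    (Set.range fun (a : ZMod m) (u : (ZMod m)ˣ) => (saw m (a * u) : ℂ)) with hD
  -- `F` is the Fourier transform of the sawtooth, so its translates u ↦ F(v u⁻¹) lie in the span.
  -- Weighted by χ(v) they add up to C·χ, with C nonzero by `sum_mul_cot_ne_zero`.
  set F : ZMod m → ℂ := fun j => -(Complex.I / 2) * Complex.cot (Real.pi * (j.val / m)) with hF
  have h1 : ∀ v : ZMod m, (fun u : (ZMod m)ˣ => F (v * (u⁻¹ : (ZMod m)ˣ))) ∈ D := by
    intro v
    have : (fun u : (ZMod m)ˣ => F (v * (u⁻¹ : (ZMod m)ˣ))) =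
        ∑ a : ZMod m, (ZMod.stdAddChar (v * a) : ℂ) •
          fun u : (ZMod m)ˣ => (saw m (a * u) : ℂ) := by
      ext u
      simp only [hF, Finset.sum_apply, Pi.smul_apply, smul_eq_mul]
      rw [← sum_saw_mul_stdAddChar]
      refine (Fintype.sum_equiv (Units.mulRight u) _ _ fun a => ?_).symm
      simp only [Units.mulRight_apply]
      rw [mul_comm,
          show v * ((u⁻¹ : (ZMod m)ˣ) : ZMod m) * (a * u) = v * a * (u⁻¹ * u : (ZMod m)ˣ) by
        push_cast; ring]
      simp
    rw [this]
    exact D.sum_mem fun a _ => D.smul_mem _ (Submodule.subset_span ⟨a, rfl⟩)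
  set C := ∑ w : ZMod m, χ w * F w with hC
  have hC0 : C ≠ 0 := by
    rw [hC]
    simp only [hF, mul_left_comm]
    rw [← mul_sum]
    exact mul_ne_zero (by simp) hχ.sum_mul_cot_ne_zero
  have h2 : C • (fun u : (ZMod m)ˣ => χ u) =
      ∑ v : ZMod m, χ v • fun u : (ZMod m)ˣ => F (v * (u⁻¹ : (ZMod m)ˣ)) := by
    ext u
    simp only [Finset.sum_apply, Pi.smul_apply, smul_eq_mul, hC, sum_mul]
    refine Fintype.sum_equiv (Units.mulRight u) _ _ fun w => ?_
    simp only [Units.mulRight_apply]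
    rw [show w * u * ((u⁻¹ : (ZMod m)ˣ) : ZMod m) = w * (u * u⁻¹ : (ZMod m)ˣ) by push_cast; ring]
    simp
    ring
  have h3 : C • (fun u : (ZMod m)ˣ => χ u) ∈ D := by
    rw [h2]
    exact D.sum_mem fun v _ => D.smul_mem _ (h1 v)
  exact (D.smul_mem_iff hC0).1 h3

/-- Since -1 ≠ 1, orthogonality gives Σ χ(-1) = 0, so odd and even characters are equally numerous.
-/
theorem DirichletCharacter.two_mul_card_odd {m : ℕ} [NeZero m] (hm : 2 < m) :
    2 * Nat.card {χ : DirichletCharacter ℂ m // χ.Odd} = m.totient := by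
  classical
  have h1 : (-1 : ZMod m) ≠ 1 := by
    have : Fact (2 < m) := ⟨hm⟩
    exact ZMod.neg_one_ne_one
  have h := DirichletCharacter.sum_characters_eq_zero ℂ h1
  have hv : ∀ χ : DirichletCharacter ℂ m, χ (-1) = 1 - 2 * if χ.Odd then 1 else 0 := by
    intro χ
    by_cases ho : χ.Odd
    · rw [if_pos ho, ho]; norm_num
    · rw [if_neg ho, χ.even_or_odd.resolve_right ho]; norm_num
  simp only [hv, sum_sub_distrib, ← mul_sum, sum_boole, sum_const, nsmul_eq_mul, mul_one] at h
  have hc := DirichletCharacter.card_eq_totient_of_hasEnoughRootsOfUnity ℂ m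
  rw [Nat.card_eq_fintype_card] at hc
  rw [card_univ, hc] at h
  rw [Nat.card_eq_fintype_card, Fintype.card_subtype]
  have h' : (m.totient : ℂ) = ((2 * #{χ : DirichletCharacter ℂ m | χ.Odd} : ℕ) : ℂ) := by
    push_cast
    linear_combination h
  exact (Nat.cast_injective h').symm

/-- A family of at most `φ(m) / 2` functions whose integral span contains all the sawtooth
functions is, together with a nonzero constant, linearly independent. -/
theorem linearIndependent_of_saw_mem_span {m : ℕ} [NeZero m] (hm : 2 < m) {κ : Type*} [Finite κ]
    (hκ : 2 * Nat.card κ ≤ m.totient) (w : κ → (ZMod m)ˣ → ℚ)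
    (hw : ∀ a : ZMod m, (fun u : (ZMod m)ˣ => saw m (a * u)) ∈ Submodule.span ℤ (Set.range w)) :
    LinearIndependent ℤ (Sum.elim w fun _ : Unit => fun _ => (1 / 2 : ℚ)) := by
  have := Fintype.ofFinite κ
  classical
  let f : ((ZMod m)ˣ → ℚ) →ₗ[ℤ] ((ZMod m)ˣ → ℂ) :=
    { toFun := fun g u => (g u : ℂ)
      map_add' := fun g h => by ext; simp
      map_smul' := fun c g => by ext; simp }
  set W : κ ⊕ Unit → (ZMod m)ˣ → ℚ := Sum.elim w fun _ : Unit => fun _ => (1 / 2 : ℚ) with hW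
  set E := Submodule.span ℂ (Set.range (f ∘ W)) with hE
  have hwE : ∀ g ∈ Submodule.span ℤ (Set.range w), f g ∈ E := by
    intro g hg
    have : Submodule.span ℤ (Set.range w) ≤ (E.restrictScalars ℤ).comap f := by
      rw [Submodule.span_le]
      rintro _ ⟨k, rfl⟩
      exact Submodule.subset_span ⟨Sum.inl k, rfl⟩
    exact this hg
  have hodd : ∀ χ : DirichletCharacter ℂ m, χ.Odd → (fun u : (ZMod m)ˣ => χ u) ∈ E := by
    intro χ hχ
    refine (Submodule.span_le.2 ?_) hχ.mem_span_saw
    rintro _ ⟨a, rfl⟩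
    exact hwE _ (hw a)
  have hone : (fun _ : (ZMod m)ˣ => (1 : ℂ)) ∈ E := by
    have : (fun _ : (ZMod m)ˣ => (1 : ℂ)) = (2 : ℂ) • (f ∘ W) (Sum.inr ()) := by
      ext u; simp [f, hW]
    rw [this]
    exact E.smul_mem _ (Submodule.subset_span ⟨_, rfl⟩)
  -- The odd characters and the trivial one are φ(m)/2 + 1 distinct characters, independent by
  -- Dedekind. They lie in the span of at most that many vectors, which forces those vectors to be
  -- independent.
  let c : {χ : DirichletCharacter ℂ m // χ.Odd} ⊕ Unit → ((ZMod m)ˣ →* ℂ) :=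
    Sum.elim (fun χ => χ.1.toMonoidHom.comp (Units.coeHom _)) fun _ => 1
  have hcinj : Function.Injective c := by
    have hodd1 : ∀ χ : {χ : DirichletCharacter ℂ m // χ.Odd},
        χ.1.toMonoidHom.comp (Units.coeHom _) ≠ 1 := by
      intro χ h
      have := DFunLike.congr_fun h (-1)
      have h2 : χ.1 (-1) = -1 := χ.2
      simp [h2] at this
      norm_num at this
    rintro (χ | _) (ψ | _) h
    · have : χ.1 = ψ.1 := MulChar.ext fun u => DFunLike.congr_fun h u
      rw [Subtype.ext this]
    · exact absurd h (hodd1 χ)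
    · exact absurd h.symm (hodd1 ψ)
    · rfl
  have hcli : LinearIndependent ℂ fun i => (c i : (ZMod m)ˣ → ℂ) :=
    (linearIndependent_monoidHom (ZMod m)ˣ ℂ).comp c hcinj
  have hcE : Submodule.span ℂ (Set.range fun i => (c i : (ZMod m)ˣ → ℂ)) ≤ E := by
    rw [Submodule.span_le]
    rintro _ ⟨χ | _, rfl⟩
    · exact hodd χ.1 χ.2
    · exact hone
  have : Fintype {χ : DirichletCharacter ℂ m // χ.Odd} := Fintype.ofFinite _
  have h1 := finrank_span_eq_card hcli
  have h2 := Submodule.finrank_mono hcE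
  have h3 := DirichletCharacter.two_mul_card_odd hm
  rw [Nat.card_eq_fintype_card] at h3 hκ
  rw [Fintype.card_sum] at h1
  have hli : LinearIndependent ℂ (f ∘ W) := by
    rw [linearIndependent_iff_card_le_finrank_span, Fintype.card_sum, Set.finrank]
    change _ ≤ Module.finrank ℂ E
    omega
  refine LinearIndependent.of_comp f (hli.restrict_scalars (R := ℤ) ?_)
  intro a b h
  simpa using h

end

/-! ### Elements of ℚ[G_m] as functions on (ℤ/m)ˣ. -/

noncomputable section

namespace Stickelberger

open Finset SignedDistribution

/-- The isomorphism `(ZMod m)ˣ ≃* G m`. -/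
def galEquiv (m : ℕ) [NeZero m] : (ZMod m)ˣ ≃* G m :=
  (IsCyclotomicExtension.autEquivPow (cyclo m)
    (Polynomial.cyclotomic.irreducible_rat (NeZero.pos m))).symm

theorem sigma_of_coprime (m : ℕ) [NeZero m] {s : ℕ} (hs : s.Coprime m) :
    sigma m s = galEquiv m (ZMod.unitOfCoprime s hs) := by
  rw [sigma, dif_pos hs, galEquiv]

theorem galEquiv_eq_sigma (m : ℕ) [NeZero m] (u : (ZMod m)ˣ) :
    galEquiv m u = sigma m (u : ZMod m).val := by
  rw [sigma_of_coprime m (ZMod.val_coe_unit_coprime u)]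
  congr 1
  ext
  simp

theorem galEquiv_apply (m : ℕ) [NeZero m] (u : (ZMod m)ˣ) (x : cyclo m) (hx : x ^ m = 1) :
    galEquiv m u x = x ^ (u : ZMod m).val := by
  rw [galEquiv_eq_sigma, sigma_apply m (ZMod.val_coe_unit_coprime u) x hx]

/-- Both automorphisms are determined by their value at a primitive n-th root of unity, where the
exponents agree modulo n. -/
theorem restr_galEquiv {m n : ℕ} [NeZero m] [NeZero n] (h : n ∣ m) (u : (ZMod m)ˣ) :
    restr h (galEquiv m u) = galEquiv n (ZMod.unitsMap h u) := by
  have hζ : IsPrimitiveRoot (IsCyclotomicExtension.zeta n ℚ (cyclo n)) n :=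
    IsCyclotomicExtension.zeta_spec n ℚ (cyclo n)
  set ζ := IsCyclotomicExtension.zeta n ℚ (cyclo n)
  have key : restr h (galEquiv m u) ζ = galEquiv n (ZMod.unitsMap h u) ζ := by
    rw [galEquiv_apply n _ _ hζ.pow_eq_one]
    apply Subtype.ext
    rw [restr_apply, galEquiv_apply]
    · have : ((ZMod.unitsMap h u : (ZMod n)ˣ) : ZMod n).val = (u : ZMod m).val % n := by
        rw [ZMod.unitsMap_val, ZMod.cast_eq_val, ZMod.val_natCast]
      rw [this, ← pow_eq_pow_mod _ hζ.pow_eq_one]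
      rfl
    · apply Subtype.ext
      obtain ⟨k, rfl⟩ := h
      have := congrArg (fun x : cyclo n => (x : ℂ)) hζ.pow_eq_one
      simp only [SubmonoidClass.coe_pow, OneMemClass.coe_one] at this ⊢
      rw [pow_mul, this, one_pow]
  apply AlgEquiv.coe_toAlgHom_injective
  apply (hζ.powerBasis ℚ).algHom_ext
  simpa using key

/-- The element of `ℚ[G m]` with the given coefficients at the `σ_u⁻¹`. -/
def ofFun (m : ℕ) [NeZero m] : ((ZMod m)ˣ → ℚ) →ₗ[ℚ] ℚ[G m] where
  toFun f := ∑ u, MonoidAlgebra.single (galEquiv m u)⁻¹ (f u)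
  map_add' f g := by simp [sum_add_distrib]
  map_smul' c f := by simp [smul_sum]

theorem ofFun_apply (m : ℕ) [NeZero m] (f : (ZMod m)ˣ → ℚ) :
    ofFun m f = ∑ u, MonoidAlgebra.single (galEquiv m u)⁻¹ (f u) := rfl

theorem ofFun_injective (m : ℕ) [NeZero m] : Function.Injective (ofFun m) := by
  rw [← LinearMap.ker_eq_bot, LinearMap.ker_eq_bot']
  intro f hf
  ext u
  classical
  have := congrArg (fun x : ℚ[G m] => x.coeff (galEquiv m u)⁻¹) hf
  simpa [ofFun_apply, Finsupp.finsetSum_apply, Finsupp.single_apply] using this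

theorem normElt_eq (m : ℕ) [NeZero m] : normElt m = ofFun m fun _ => 1 := by
  rw [normElt, ofFun_apply]
  exact (Fintype.sum_equiv ((galEquiv m).toEquiv.trans (Equiv.inv _)) _ _ fun u => rfl).symm

theorem theta_eq (m : ℕ) [NeZero m] (a : ℤ) :
    theta m a = ofFun m fun u => Int.fract (((-(a * (u : ZMod m)) : ZMod m).val : ℚ) / m) := by
  rw [theta, ofFun_apply]
  refine sum_bij (fun s hs => ZMod.unitOfCoprime s (mem_filter.1 hs).2) (by simp) ?_ ?_ ?_
  · intro s hs s' hs' h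
    have h1 : (s : ZMod m) = s' := congrArg (fun u : (ZMod m)ˣ => (u : ZMod m)) h
    rw [ZMod.natCast_eq_natCast_iff] at h1
    simp only [mem_filter, mem_Ioc] at hs hs'
    have h2 : (m : ℤ) ∣ s' - s := h1.dvd
    have h3 : ((s' : ℤ) - s) = 0 := Int.eq_zero_of_abs_lt_dvd h2 (by rw [abs_lt]; omega)
    omega
  · intro u _
    have hc := ZMod.val_coe_unit_coprime u
    have hlt := ZMod.val_lt (u : ZMod m)
    -- This happens only for m = 1, where the summation index is s = m and not 0.
    by_cases h0 : (u : ZMod m).val = 0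
    · rw [h0, Nat.coprime_zero_left] at hc
      refine ⟨m, by simp [hc], ?_⟩
      have : Subsingleton (ZMod m) := by rw [hc]; infer_instance
      exact Subsingleton.elim _ _
    · refine ⟨(u : ZMod m).val, ?_, ?_⟩
      · simp only [mem_filter, mem_Ioc]
        exact ⟨⟨Nat.pos_of_ne_zero h0, hlt.le⟩, hc⟩
      · ext; simp
  · intro s hs
    rw [sigma_of_coprime m (mem_filter.1 hs).2]
    congr 1
    have := fract_intCast_div m (-(a * s))
    rw [fract_val_div]
    push_cast at this
    simpa using this

theorem omega_eq (m : ℕ) [NeZero m] (a : ℤ) :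
    omega m a = ofFun m fun u => saw m (-(a * (u : ZMod m))) := by
  rw [omega]
  split_ifs with h
  · have h0 : (a : ZMod m) = 0 := (ZMod.intCast_zmod_eq_zero_iff_dvd a m).2 h
    simp only [h0, zero_mul, neg_zero, saw_zero]
    exact (map_zero (ofFun m)).symm
  · rw [theta_eq, normElt_eq, ← map_smul, ← map_sub]
    congr 1
    ext u
    have h0 : ((-(a * (u : ZMod m)) : ZMod m)).val ≠ 0 := by
      rw [ZMod.val_ne_zero, neg_ne_zero, Ne, Units.mul_left_eq_zero]
      rwa [ZMod.intCast_zmod_eq_zero_iff_dvd]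
    rw [saw_eq, if_neg h0, Pi.sub_apply, fract_val_div]
    simp

theorem res_ofFun {m n : ℕ} [NeZero m] [NeZero n] (h : n ∣ m) (f : (ZMod m)ˣ → ℚ) :
    res h (ofFun m f) = ofFun n fun v => ∑ u with ZMod.unitsMap h u = v, f u := by
  rw [ofFun_apply, map_sum, ofFun_apply]
  have h1 : ∀ u, res h (MonoidAlgebra.single (galEquiv m u)⁻¹ (f u)) =
      MonoidAlgebra.single (galEquiv n (ZMod.unitsMap h u))⁻¹ (f u) := by
    intro u
    simp [res, restr_galEquiv]
  rw [sum_congr rfl fun u _ => h1 u, ← sum_fiberwise univ (ZMod.unitsMap h)]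
  refine sum_congr rfl fun v _ => ?_
  rw [← MonoidAlgebra.singleAddHom_apply, map_sum]
  refine sum_congr rfl fun u hu => ?_
  rw [(mem_filter.1 hu).2]
  rfl

theorem cor_ofFun {m n : ℕ} [NeZero m] [NeZero n] (h : n ∣ m) (g : (ZMod n)ˣ → ℚ) :
    cor h (ofFun n g) = ofFun m fun u => g (ZMod.unitsMap h u) := by
  classical
  rw [ofFun_apply, map_sum, ofFun_apply, ← sum_fiberwise univ (ZMod.unitsMap h)]
  refine sum_congr rfl fun v _ => ?_
  rw [cor_single, smul_sum]
  refine (sum_bij (fun u _ => (galEquiv m u)⁻¹) ?_ ?_ ?_ ?_).symm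
  · intro u hu
    simp [restr_galEquiv, (mem_filter.1 hu).2]
  · intro u _ u' _ huu
    simpa using huu
  · intro σ hσ
    refine ⟨(galEquiv m).symm σ⁻¹, ?_, by simp⟩
    have h1 := (mem_filter.1 hσ).2
    rw [mem_filter]
    refine ⟨mem_univ _, (galEquiv n).injective ?_⟩
    rw [← restr_galEquiv, MulEquiv.apply_symm_apply, map_inv, h1, inv_inv]
  · intro u hu
    rw [(mem_filter.1 hu).2]
    simp

theorem thetaRel_eq (m n : ℕ) [NeZero m] [NeZero n] (a : ℤ) :
    thetaRel m n a = ofFun m fun u =>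
      ∑ w with ZMod.unitsMap (Nat.gcd_dvd_right m n) w = ZMod.unitsMap (Nat.gcd_dvd_left m n) u,
        Int.fract (((-(a * (w : ZMod n)) : ZMod n).val : ℚ) / n) := by
  rw [thetaRel, theta_eq, res_ofFun, cor_ofFun]

/-! ### Fibre sums and pullbacks of sawtooth functions; Sinnott's group. -/

/-- The group of functions on `(ZMod d)ˣ` generated by the sawtooth functions. -/
def sawGroup (d : ℕ) : AddSubgroup ((ZMod d)ˣ → ℚ) :=
  AddSubgroup.closure (Set.range fun (b : ZMod d) (u : (ZMod d)ˣ) => saw d (b * u))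

theorem saw_mem_sawGroup {d : ℕ} (b : ZMod d) :
    (fun u : (ZMod d)ˣ => saw d (b * u)) ∈ sawGroup d :=
  AddSubgroup.subset_closure ⟨b, rfl⟩

/-- Summation over the fibres of `(ZMod n)ˣ → (ZMod d)ˣ`. -/
def fiberSum {n d : ℕ} [NeZero n] [NeZero d] (h : d ∣ n) :
    ((ZMod n)ˣ → ℚ) →+ ((ZMod d)ˣ → ℚ) where
  toFun f v := ∑ u with ZMod.unitsMap h u = v, f u
  map_zero' := by ext; simp
  map_add' f g := by ext; simp [sum_add_distrib]

theorem fiberSum_apply {n d : ℕ} [NeZero n] [NeZero d] (h : d ∣ n) (f : (ZMod n)ˣ → ℚ)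
    (v : (ZMod d)ˣ) : fiberSum h f v = ∑ u with ZMod.unitsMap h u = v, f u := rfl

theorem fiberSum_fiberSum {n k d : ℕ} [NeZero n] [NeZero k] [NeZero d] (h : k ∣ n) (h' : d ∣ k)
    (f : (ZMod n)ˣ → ℚ) : fiberSum h' (fiberSum h f) = fiberSum (h'.trans h) f := by
  ext v
  simp only [fiberSum_apply]
  rw [← sum_fiberwise_of_maps_to (s := {u : (ZMod n)ˣ | ZMod.unitsMap (h'.trans h) u = v})
    (t := {w : (ZMod k)ˣ | ZMod.unitsMap h' w = v}) (g := ZMod.unitsMap h)]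
  · refine sum_congr rfl fun w hw => sum_congr ?_ fun _ _ => rfl
    have hw := (mem_filter.1 hw).2
    ext u
    simp only [mem_filter, mem_univ, true_and]
    refine ⟨fun hu => ⟨?_, hu⟩, fun hu => hu.2⟩
    rw [← hw, ← hu, ← ZMod.unitsMap_comp h' h]
    rfl
  · intro u hu
    have hu := (mem_filter.1 hu).2
    simp only [mem_filter, mem_univ, true_and]
    rw [← hu, ← ZMod.unitsMap_comp h' h]
    rfl

theorem castHom_eq_iff {n d : ℕ} [NeZero n] [NeZero d] (h : d ∣ n) (x y : ZMod n) :
    ZMod.castHom h (ZMod d) x = ZMod.castHom h (ZMod d) y ↔ x.val % d = y.val % d := by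
  have e : ∀ x : ZMod n, ZMod.castHom h (ZMod d) x = (x.val : ZMod d) := fun x => by
    rw [ZMod.castHom_apply, ZMod.cast_eq_val]
  rw [e, e, ZMod.natCast_eq_natCast_iff, Nat.ModEq]

theorem card_castHom_fiber {n d : ℕ} [NeZero n] [NeZero d] (h : d ∣ n) (v : ZMod d) :
    #{x : ZMod n | ZMod.castHom h (ZMod d) x = v} =
      #{x : ZMod n | ZMod.castHom h (ZMod d) x = 0} :=
  AddMonoidHom.card_fiber_eq_of_mem_range (ZMod.castHom h (ZMod d)).toAddMonoidHom
    (ZMod.castHom_surjective h v) (ZMod.castHom_surjective h 0)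

/-- If p divides a, then ax depends only on x modulo d. Otherwise multiplication by a carries the
fibre onto a fibre of multiplication by p, and the distribution relation applies. -/
theorem exists_sum_castHom_fiber {n d p : ℕ} [NeZero n] [NeZero d] (hp : p.Prime)
    (hn : n = p * d) (h : d ∣ n) (a : ZMod n) :
    ∃ (b : ZMod d) (c : ℕ), ∀ v : ZMod d,
      ∑ x with ZMod.castHom h (ZMod d) x = v, saw n (a * x) = c • saw d (b * v) := by
  have hcast : ∀ x : ZMod n, ((x.val : ℤ) : ZMod d) = ZMod.castHom h (ZMod d) x := fun x => by
    rw [ZMod.castHom_apply, ZMod.cast_eq_val, Int.cast_natCast]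
  by_cases hpa : p ∣ a.val
  · obtain ⟨z, hz⟩ := hpa
    refine ⟨z, #{x : ZMod n | ZMod.castHom h (ZMod d) x = 0}, fun v => ?_⟩
    rw [← card_castHom_fiber h v, ← sum_const]
    refine sum_congr rfl fun x hx => ?_
    have hx := (mem_filter.1 hx).2
    have : a * x = ((p * (z * x.val : ℤ) : ℤ) : ZMod n) := by
      conv_lhs => rw [← ZMod.natCast_zmod_val a, ← ZMod.natCast_zmod_val x, hz]
      push_cast
      ring
    rw [this, saw_mul_intCast hn, ← hx, Int.cast_mul, hcast, Int.cast_natCast]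
  · refine ⟨ZMod.castHom h (ZMod d) a, 1, fun v => ?_⟩
    obtain ⟨x0, rfl⟩ := ZMod.castHom_surjective h v
    have hcop : IsCoprime (a.val : ℤ) (p : ℤ) :=
      Nat.isCoprime_iff_coprime.2 ((hp.coprime_iff_not_dvd.2 hpa).symm)
    obtain ⟨r, s, hrs⟩ := hcop
    have hrs' : (r : ZMod n) * a + s * p = 1 := by
      have := congrArg (fun z : ℤ => (z : ZMod n)) hrs
      push_cast at this
      rwa [ZMod.natCast_zmod_val] at this
    have hiff : ∀ x : ZMod n, ZMod.castHom h (ZMod d) x = ZMod.castHom h (ZMod d) x0 ↔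
        (p : ZMod n) * x = p * x0 := fun x => by
      rw [castHom_eq_iff, natCast_mul_eq_iff hn]
    have h1 : ∑ x with ZMod.castHom h (ZMod d) x = ZMod.castHom h (ZMod d) x0, saw n (a * x) =
        ∑ b with (p : ZMod n) * b = p * (a * x0), saw n b := by
      -- The inverse comes from x = r(ax) + s(px), where px = p·x0 is fixed on the fibre.
      refine sum_bij' (fun x _ => a * x) (fun b _ => r * b + s * (p * x0)) ?_ ?_ ?_ ?_ ?_
      · intro x hx
        have hx := (hiff x).1 (mem_filter.1 hx).2
        simp only [mem_filter, mem_univ, true_and]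
        linear_combination a * hx
      · intro b hb
        have hb := (mem_filter.1 hb).2
        refine mem_filter.2 ⟨mem_univ _, (hiff _).2 ?_⟩
        linear_combination (r : ZMod n) * hb + (p : ZMod n) * x0 * hrs'
      · intro x hx
        have hx := (hiff x).1 (mem_filter.1 hx).2
        linear_combination x * hrs' - (s : ZMod n) * hx
      · intro b hb
        have hb := (mem_filter.1 hb).2
        linear_combination b * hrs' - (s : ZMod n) * hb
      · simp
    rw [h1, sum_saw (hn ▸ dvd_mul_right p d), one_smul, ← map_mul, ← hcast, ← saw_mul_intCast hn]
    simp

theorem fiberSum_eq_sum_castHom {n d : ℕ} [NeZero n] [NeZero d] (h : d ∣ n) (f : ZMod n → ℚ)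
    (v : (ZMod d)ˣ) : fiberSum h (fun u => f u) v =
      ∑ x with ZMod.castHom h (ZMod d) x = v ∧ IsUnit x, f x := by
  rw [fiberSum_apply]
  refine sum_bij (fun u _ => (u : ZMod n)) ?_ ?_ ?_ ?_
  · intro u hu
    have hu := (mem_filter.1 hu).2
    simp [← hu, ZMod.unitsMap_val]
  · intro u _ u' _ huu
    exact Units.ext huu
  · intro x hx
    obtain ⟨hx, u, rfl⟩ := (mem_filter.1 hx).2
    refine ⟨u, ?_, rfl⟩
    refine mem_filter.2 ⟨mem_univ _, Units.ext ?_⟩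
    rw [← hx, ZMod.unitsMap_val, ZMod.castHom_apply]
  · simp

theorem isUnit_iff_not_dvd {n d p : ℕ} [NeZero n] [NeZero d] (hp : p.Prime) (hn : n = p * d)
    (h : d ∣ n) {x : ZMod n} (hx : IsUnit (ZMod.castHom h (ZMod d) x)) :
    IsUnit x ↔ ¬ p ∣ x.val := by
  rw [ZMod.castHom_apply, ZMod.cast_eq_val, ZMod.isUnit_iff_coprime] at hx
  conv_lhs => rw [← ZMod.natCast_zmod_val x]
  rw [ZMod.isUnit_iff_coprime, ← hp.coprime_iff_not_dvd, Nat.coprime_comm (n := p)]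
  have e : x.val.Coprime n ↔ x.val.Coprime (p * d) := by rw [← hn]
  rw [e, Nat.coprime_mul_iff_right]
  exact ⟨fun h => h.1, fun h => ⟨h, hx⟩⟩

/-- If p ∣ d, every lift of a unit is a unit. If p ∤ d, exactly one lift is not, namely the multiple
of p; its term is a sawtooth value at level d, and is subtracted from the full fibre sum. -/
theorem fiberSum_prime_mem {n d p : ℕ} [NeZero n] [NeZero d] (hp : p.Prime)
    (hn : n = p * d) (h : d ∣ n) (a : ZMod n) :
    fiberSum h (fun u => saw n (a * u)) ∈ sawGroup d := by
  obtain ⟨b, c, hbc⟩ := exists_sum_castHom_fiber hp hn h a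
  have hall : (fun v : (ZMod d)ˣ => ∑ x with ZMod.castHom h (ZMod d) x = v, saw n (a * x)) ∈
      sawGroup d := by
    have : (fun v : (ZMod d)ˣ => ∑ x with ZMod.castHom h (ZMod d) x = v, saw n (a * x)) =
        c • fun v : (ZMod d)ˣ => saw d (b * v) := by
      ext v; rw [hbc v]; rfl
    rw [this]
    exact (sawGroup d).nsmul_mem (saw_mem_sawGroup b) c
  by_cases hpd : p ∣ d
  · convert hall using 1
    ext v
    rw [fiberSum_eq_sum_castHom h (fun x => saw n (a * x))]
    refine sum_congr ?_ fun _ _ => rfl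
    ext x
    simp only [mem_filter, mem_univ, true_and, and_iff_left_iff_imp]
    intro hx
    have hxu : IsUnit (ZMod.castHom h (ZMod d) x) := hx ▸ v.isUnit
    rw [isUnit_iff_not_dvd hp hn h hxu]
    rw [ZMod.castHom_apply, ZMod.cast_eq_val, ZMod.isUnit_iff_coprime] at hxu
    intro hpx
    exact hp.one_lt.ne' (Nat.eq_one_of_dvd_coprimes hxu hpx hpd)
  · have hcop : IsCoprime (p : ℤ) (d : ℤ) :=
      Nat.isCoprime_iff_coprime.2 (hp.coprime_iff_not_dvd.2 hpd)
    obtain ⟨r, s, hrs⟩ := hcop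
    have hsub : fiberSum h (fun u => saw n (a * u)) =
        (fun v : (ZMod d)ˣ => ∑ x with ZMod.castHom h (ZMod d) x = v, saw n (a * x)) -
          fun v : (ZMod d)ˣ => saw d ((a.val * r : ℤ) * v) := by
      ext v
      rw [Pi.sub_apply, fiberSum_eq_sum_castHom h (fun x => saw n (a * x)), eq_sub_iff_add_eq,
        ← filter_filter, ← sum_filter_add_sum_filter_not
          ({x : ZMod n | ZMod.castHom h (ZMod d) x = v}) IsUnit]
      congr 1
      -- `r` inverts p modulo d, so p·r·v is the lift of v divisible by p.
      have hx0 : ZMod.castHom h (ZMod d) ((p * (r * (v : ZMod d).val) : ℤ) : ZMod n) = v := by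
        have h1 : (p : ZMod d) * r = 1 := by
          have := congrArg (fun z : ℤ => (z : ZMod d)) hrs
          push_cast at this
          rw [ZMod.natCast_self, mul_zero, add_zero] at this
          rw [mul_comm]; exact this
        rw [map_intCast]
        push_cast
        rw [ZMod.natCast_zmod_val, ← mul_assoc, h1, one_mul]
      have hdvd : ∀ y : ℤ, (p : ℤ) ∣ y ↔ p ∣ (y : ZMod n).val := by
        intro y
        have h1 : (((y : ZMod n).val : ℤ)) = y % n := ZMod.val_intCast y
        rw [← Int.natCast_dvd_natCast, h1]
        have h2 : (p : ℤ) ∣ n := by rw [hn]; push_cast; exact dvd_mul_right _ _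
        exact (Int.dvd_iff_dvd_of_dvd_sub
          (h2.trans ⟨y / n, by have := Int.emod_add_mul_ediv y n; linarith⟩))
      have hset : ({x ∈ ({x : ZMod n | ZMod.castHom h (ZMod d) x = v} : Finset (ZMod n)) |
          ¬ IsUnit x}) = {((p * (r * (v : ZMod d).val) : ℤ) : ZMod n)} := by
        ext x
        simp only [mem_filter, mem_univ, true_and, mem_singleton]
        constructor
        · rintro ⟨hx, hxu⟩
          rw [isUnit_iff_not_dvd hp hn h (hx ▸ v.isUnit), not_not] at hxu
          set y : ℤ := p * (r * (v : ZMod d).val) with hy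
          have hxy : ((x.val : ℤ) : ZMod d) = (y : ZMod d) := by
            rw [← map_intCast (ZMod.castHom h (ZMod d)) y, hx0, ← hx, ZMod.castHom_apply,
              ZMod.cast_eq_val, Int.cast_natCast]
          have h1 : (d : ℤ) ∣ y - x.val := (ZMod.intCast_eq_intCast_iff_dvd_sub _ _ _).1 hxy
          have h2 : (p : ℤ) ∣ y - x.val :=
            dvd_sub (dvd_mul_right _ _) (Int.natCast_dvd_natCast.2 hxu)
          have h3 : (n : ℤ) ∣ y - x.val := by
            rw [show (n : ℤ) = p * d by exact_mod_cast hn]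
            exact (Nat.isCoprime_iff_coprime.2 (hp.coprime_iff_not_dvd.2 hpd)).mul_dvd h2 h1
          rw [← (ZMod.intCast_eq_intCast_iff_dvd_sub _ _ _).2 h3]
          simp
        · intro hx
          rw [hx]
          refine ⟨hx0, ?_⟩
          rw [isUnit_iff_not_dvd hp hn h (by rw [hx0]; exact v.isUnit), not_not, ← hdvd]
          exact dvd_mul_right _ _
      rw [hset, sum_singleton]
      have e : a * ((p * (r * (v : ZMod d).val) : ℤ) : ZMod n) =
          ((p * (a.val * r * (v : ZMod d).val) : ℤ) : ZMod n) := by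
        conv_lhs => rw [← ZMod.natCast_zmod_val a]
        push_cast
        ring
      rw [e, saw_mul_intCast hn]
      push_cast
      rw [ZMod.natCast_zmod_val]
    rw [hsub]
    exact (sawGroup d).sub_mem hall (saw_mem_sawGroup _)

theorem fiberSum_mem_of_forall {n d : ℕ} [NeZero n] [NeZero d] (h : d ∣ n)
    (hs : ∀ a : ZMod n, fiberSum h (fun u => saw n (a * u)) ∈ sawGroup d) {f : (ZMod n)ˣ → ℚ}
    (hf : f ∈ sawGroup n) : fiberSum h f ∈ sawGroup d := by
  have : sawGroup n ≤ (sawGroup d).comap (fiberSum h) := by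
    rw [sawGroup, AddSubgroup.closure_le]
    rintro _ ⟨a, rfl⟩
    exact hs a
  exact this hf

theorem fiberSum_mem {n d : ℕ} [NeZero n] [NeZero d] (h : d ∣ n) {f : (ZMod n)ˣ → ℚ}
    (hf : f ∈ sawGroup n) : fiberSum h f ∈ sawGroup d := by
  obtain ⟨k, hk⟩ := id h
  induction k using induction_on_primes generalizing n with
  | zero => exact absurd (by simpa using hk) (NeZero.ne n)
  | one =>
    rw [mul_one] at hk
    subst hk
    convert hf using 1
    ext v
    have : ∀ u, ZMod.unitsMap h u = u := fun u => by
      rw [ZMod.unitsMap_self]; rfl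
    simp only [fiberSum_apply, this, sum_filter, sum_ite_eq', mem_univ, if_true]
  | prime_mul p k hp ih =>
    have hk0 : NeZero (d * k) := ⟨by
      rintro h0
      exact NeZero.ne n (by rw [hk, mul_left_comm, h0, mul_zero])⟩
    have hn : n = p * (d * k) := by rw [hk]; ring
    have h1 : d * k ∣ n := hn ▸ dvd_mul_left _ _
    rw [← fiberSum_fiberSum h1 (dvd_mul_right d k)]
    exact ih (dvd_mul_right d k)
      (fiberSum_mem_of_forall h1 (fun a => fiberSum_prime_mem hp hn h1 a) hf) rfl

/-- A sawtooth value y/d is also (m/d)y/m, so pulling back multiplies the parameter by m/d. -/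
theorem comp_unitsMap_mem {m d : ℕ} [NeZero m] [NeZero d] (h : d ∣ m) {f : (ZMod d)ˣ → ℚ}
    (hf : f ∈ sawGroup d) : (fun u => f (ZMod.unitsMap h u)) ∈ sawGroup m := by
  let F : ((ZMod d)ˣ → ℚ) →+ ((ZMod m)ˣ → ℚ) :=
    { toFun := fun f u => f (ZMod.unitsMap h u), map_zero' := rfl, map_add' := fun _ _ => rfl }
  have : sawGroup d ≤ (sawGroup m).comap F := by
    rw [sawGroup, AddSubgroup.closure_le]
    rintro _ ⟨b, rfl⟩
    obtain ⟨k, hk⟩ := h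
    have : F (fun u => saw d (b * u)) = fun u : (ZMod m)ˣ => saw m ((k * b.val : ℤ) * u) := by
      ext u
      have e : ((k * b.val : ℤ) : ZMod m) * (u : ZMod m) =
          ((k * (b.val * (u : ZMod m).val : ℤ) : ℤ) : ZMod m) := by
        conv_lhs => rw [← ZMod.natCast_zmod_val (u : ZMod m)]
        push_cast
        ring
      rw [e, saw_mul_intCast (hk.trans (mul_comm _ _))]
      change saw d (b * (ZMod.unitsMap ⟨k, hk⟩ u : (ZMod d)ˣ)) = _
      rw [ZMod.unitsMap_val, ZMod.cast_eq_val]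
      push_cast
      rw [ZMod.natCast_zmod_val]
    change F _ ∈ sawGroup m
    rw [this]
    exact saw_mem_sawGroup _
  exact this hf

/-- The constant function with value `½` and the sawtooth functions. -/
def halfSawGroup (m : ℕ) : AddSubgroup ((ZMod m)ˣ → ℚ) :=
  sawGroup m ⊔ AddSubgroup.zmultiples fun _ => 1 / 2

theorem half_mem_halfSawGroup (m : ℕ) : (fun _ => 1 / 2) ∈ halfSawGroup m :=
  (le_sup_right : _ ≤ halfSawGroup m) (AddSubgroup.mem_zmultiples _)

theorem fract_eq_saw_add {n : ℕ} [NeZero n] (x : ZMod n) :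
    Int.fract ((x.val : ℚ) / n) = saw n x + if x = 0 then 0 else 1 / 2 := by
  rw [fract_val_div, saw_eq]
  by_cases h : x = 0
  · simp [h]
  · rw [if_neg ((ZMod.val_ne_zero _).2 h), if_neg h]; ring

/-- The fractional part exceeds the sawtooth by ½ except at integers, where both vanish. Which case
occurs depends on `a` alone, and all fibres have equally many elements, so the discrepancy is a
constant integral multiple of ½. -/
theorem thetaRel_mem (m n : ℕ) [NeZero m] [NeZero n] (a : ℤ) :
    thetaRel m n a ∈ (halfSawGroup m).map (ofFun m).toAddMonoidHom := by
  rw [thetaRel_eq]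
  refine ⟨_, ?_, rfl⟩
  have h1 : (fun u : (ZMod m)ˣ => fiberSum (Nat.gcd_dvd_right m n)
      (fun w => saw n ((-a : ℤ) * w)) (ZMod.unitsMap (Nat.gcd_dvd_left m n) u)) ∈ sawGroup m :=
    comp_unitsMap_mem _ (fiberSum_mem _ (saw_mem_sawGroup _))
  set c := #{w : (ZMod n)ˣ | ZMod.unitsMap (Nat.gcd_dvd_right m n) w = 1} with hc
  have h2 : (fun _ : (ZMod m)ˣ => (if (a : ZMod n) = 0 then 0 else c • (1 / 2 : ℚ))) ∈
      halfSawGroup m := by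
    split_ifs
    · exact (halfSawGroup m).zero_mem
    · exact (halfSawGroup m).nsmul_mem (half_mem_halfSawGroup m) c
  have h3 := (halfSawGroup m).add_mem ((le_sup_left : _ ≤ halfSawGroup m) h1) h2
  change _ ∈ halfSawGroup m
  convert h3 using 1
  ext u
  rw [Pi.add_apply, fiberSum_apply]
  have hcard : c = #{w : (ZMod n)ˣ | ZMod.unitsMap (Nat.gcd_dvd_right m n) w =
      ZMod.unitsMap (Nat.gcd_dvd_left m n) u} :=
    MonoidHom.card_fiber_eq_of_mem_range (ZMod.unitsMap (Nat.gcd_dvd_right m n))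
      (ZMod.unitsMap_surjective _ _) (ZMod.unitsMap_surjective _ _)
  have h0 : ∀ w : (ZMod n)ˣ, (-(a * (w : ZMod n)) = 0) ↔ (a : ZMod n) = 0 := fun w => by
    rw [neg_eq_zero, Units.mul_left_eq_zero]
  simp only [fract_eq_saw_add, sum_add_distrib, h0, sum_const, ← hcard]
  congr 1
  · refine sum_congr rfl fun w _ => ?_
    push_cast
    rw [neg_mul]
  · split_ifs <;> simp

/-- The source of ½N_m in Sinnott's group: (ℤ/2)ˣ is trivial and ⟨-½⟩ = ½. -/
theorem thetaRel_two_one (m : ℕ) [NeZero m] : thetaRel m 2 1 = ofFun m fun _ => 1 / 2 := by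
  rw [thetaRel_eq]
  congr 1
  ext u
  have hsub : ∀ d, d ∣ 2 → Subsingleton (ZMod d)ˣ := by
    intro d hd
    rcases (Nat.dvd_prime Nat.prime_two).1 hd with rfl | rfl <;> infer_instance
  have := hsub _ (Nat.gcd_dvd_right m 2)
  rw [filter_true_of_mem fun w _ => Subsingleton.elim _ _]
  have hu : (univ : Finset (ZMod 2)ˣ) = {1} := by decide
  rw [hu, sum_singleton]
  have hv : (-(((1 : ℤ) : ZMod 2) * ((1 : (ZMod 2)ˣ) : ZMod 2))).val = 1 := by decide
  rw [hv]
  norm_num [Int.fract]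

theorem thetaRel_self (m : ℕ) [NeZero m] (a : ℤ) : thetaRel m m a = theta m a := by
  rw [thetaRel_eq, theta_eq]
  congr 1
  ext u
  -- `Nat.gcd m m` equals `m` only propositionally, so injectivity is proved for a variable divisor
  -- `d` equal to `m`.
  have hinj : ∀ d (h : d ∣ m), d = m → Function.Injective (ZMod.unitsMap h) := by
    rintro d h rfl
    rw [ZMod.unitsMap_self]
    exact Function.injective_id
  have : ({w : (ZMod m)ˣ | ZMod.unitsMap (Nat.gcd_dvd_right m m) w =
      ZMod.unitsMap (Nat.gcd_dvd_left m m) u} : Finset (ZMod m)ˣ) = {u} := by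
    ext w
    simp only [mem_filter, mem_univ, true_and, mem_singleton]
    exact (hinj _ _ (Nat.gcd_self m)).eq_iff
  rw [this, sum_singleton]

theorem sinnottGroup_eq (m : ℕ) [NeZero m] :
    sinnottGroup m = (halfSawGroup m).map (ofFun m).toAddMonoidHom := by
  apply le_antisymm
  · rw [sinnottGroup, AddSubgroup.closure_le]
    rintro _ ⟨n, _, a, rfl⟩
    exact thetaRel_mem m n a
  · have hhalf : ofFun m (fun _ => 1 / 2) ∈ sinnottGroup m :=
      AddSubgroup.subset_closure ⟨2, inferInstance, 1, (thetaRel_two_one m).symm⟩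
    rw [AddSubgroup.map_le_iff_le_comap, halfSawGroup, sup_le_iff, sawGroup,
      AddSubgroup.closure_le, AddSubgroup.zmultiples_le]
    refine ⟨?_, hhalf⟩
    rintro _ ⟨b, rfl⟩
    have h1 : omega m (-(b.val : ℤ)) = ofFun m fun u => saw m (b * u) := by
      rw [omega_eq]
      simp
    change ofFun m _ ∈ sinnottGroup m
    rw [← h1, omega]
    split_ifs
    · exact (sinnottGroup m).zero_mem
    · refine (sinnottGroup m).sub_mem ?_ ?_
      · exact AddSubgroup.subset_closure ⟨m, inferInstance, _, (thetaRel_self m _).symm⟩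
      · rw [normElt_eq, ← map_smul]
        convert hhalf using 2
        ext; simp

/-! ### Units with zero, and the half system below n/2. -/

section WithZeroUnits

variable {n : ℕ}

/-- The inclusion of the units and zero into `ZMod n`. -/
def toZMod (n : ℕ) : WithZero (ZMod n)ˣ →*₀ ZMod n := WithZero.lift' (Units.coeHom (ZMod n))

theorem toZMod_coe (u : (ZMod n)ˣ) : toZMod n (u : WithZero (ZMod n)ˣ) = u := by
  simp [toZMod]

theorem isUnit_toZMod {x : WithZero (ZMod n)ˣ} (hx : x ≠ 0) : IsUnit (toZMod n x) := by
  obtain ⟨u, rfl⟩ := WithZero.ne_zero_iff_exists.1 hx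
  rw [toZMod_coe]
  exact u.isUnit

theorem toZMod_eq_zero_iff (hn : 1 < n) {x : WithZero (ZMod n)ˣ} : toZMod n x = 0 ↔ x = 0 := by
  have : Fact (1 < n) := ⟨hn⟩
  refine ⟨fun h => ?_, fun h => by rw [h, map_zero]⟩
  by_contra hx
  exact (isUnit_toZMod hx).ne_zero h

theorem toZMod_injective (hn : 1 < n) : Function.Injective (toZMod n) := by
  intro x y h
  by_cases hx : x = 0
  · subst hx
    rw [map_zero] at h
    exact ((toZMod_eq_zero_iff hn).1 h.symm).symm
  · have hy : y ≠ 0 := by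
      rintro rfl
      rw [map_zero] at h
      exact hx ((toZMod_eq_zero_iff hn).1 h)
    obtain ⟨u, rfl⟩ := WithZero.ne_zero_iff_exists.1 hx
    obtain ⟨v, rfl⟩ := WithZero.ne_zero_iff_exists.1 hy
    rw [toZMod_coe, toZMod_coe] at h
    rw [Units.ext h]

theorem exists_toZMod_eq {z : ZMod n} (hz : z = 0 ∨ IsUnit z) : ∃ x, toZMod n x = z := by
  rcases hz with rfl | ⟨u, rfl⟩
  · exact ⟨0, map_zero _⟩
  · exact ⟨u, toZMod_coe u⟩

/-- The element `-1` of the units with zero. -/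
def negOne (n : ℕ) : WithZero (ZMod n)ˣ := ((-1 : (ZMod n)ˣ) : WithZero (ZMod n)ˣ)

theorem toZMod_negOne : toZMod n (negOne n) = -1 := by
  rw [negOne, toZMod_coe]; simp

theorem negOne_ne_zero : negOne n ≠ 0 := WithZero.coe_ne_zero

theorem negOne_mul_self : negOne n * negOne n = 1 := by
  rw [negOne, ← WithZero.coe_mul]; simp

theorem negOne_ne_one (hn : 2 < n) : negOne n ≠ 1 := by
  intro h
  have h1 := congrArg (toZMod n) h
  rw [toZMod_negOne, map_one] at h1
  have : Fact (2 < n) := ⟨hn⟩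
  exact ZMod.neg_one_ne_one h1

instance fintypeWithZeroUnits (n : ℕ) [NeZero n] : Fintype (WithZero (ZMod n)ˣ) :=
  inferInstanceAs (Fintype (Option (ZMod n)ˣ))

open Classical in
/-- The units below `n / 2`. -/
def lowerHalf (n : ℕ) [NeZero n] : Finset (WithZero (ZMod n)ˣ) :=
  {x | x ≠ 0 ∧ 2 * (toZMod n x).val < n}

variable [NeZero n]

theorem mem_lowerHalf {x : WithZero (ZMod n)ˣ} (hx : x ≠ 0) :
    x ∈ lowerHalf n ↔ 2 * (toZMod n x).val < n := by
  simp [lowerHalf, hx]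

theorem one_mem_lowerHalf (hn : 2 < n) : 1 ∈ lowerHalf n := by
  have : Fact (1 < n) := ⟨by omega⟩
  rw [mem_lowerHalf one_ne_zero, map_one, ZMod.val_one]
  exact hn

theorem negOne_mul_mem_lowerHalf (hn : 2 < n) {x : WithZero (ZMod n)ˣ} (hx : x ≠ 0) :
    negOne n * x ∈ lowerHalf n ↔ x ∉ lowerHalf n := by
  rw [mem_lowerHalf (mul_ne_zero negOne_ne_zero hx), mem_lowerHalf hx, map_mul, toZMod_negOne,
    neg_one_mul, ZMod.neg_val, if_neg fun h => hx ((toZMod_eq_zero_iff (by omega)).1 h)]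
  have hlt := ZMod.val_lt (toZMod n x)
  have hu := isUnit_toZMod hx
  rw [← ZMod.natCast_zmod_val (toZMod n x), ZMod.isUnit_iff_coprime] at hu
  -- A unit equal to n/2 would divide n, hence be 1, which gives n = 2.
  have hne : 2 * (toZMod n x).val ≠ n := by
    intro h
    have h1 : (toZMod n x).val ∣ n := ⟨2, by omega⟩
    have := Nat.eq_one_of_dvd_coprimes hu dvd_rfl h1
    omega
  omega

theorem card_withZero_units : Fintype.card (WithZero (ZMod n)ˣ) - 1 = n.totient := by
  rw [show Fintype.card (WithZero (ZMod n)ˣ) = Fintype.card (Option (ZMod n)ˣ) from rfl,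
    Fintype.card_option, ZMod.card_units_eq_totient, Nat.add_sub_cancel]

end WithZeroUnits

/-! ### Residues modulo ∏ q_i encoded by tuples, and their norm relations. -/

variable {t : ℕ} {q : Fin t → ℕ}

/-- The projection `ZMod (∏ i, q i) →+* ZMod (q i)`. -/
def coord (q : Fin t → ℕ) (i : Fin t) : ZMod (∏ i, q i) →+* ZMod (q i) :=
  ZMod.castHom (dvd_prod_of_mem q (mem_univ i)) (ZMod (q i))

theorem coord_ext (hcop : Pairwise fun i j => (q i).Coprime (q j)) {a b : ZMod (∏ i, q i)}
    (h : ∀ i, coord q i a = coord q i b) : a = b := by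
  refine (ZMod.prodEquivPi q hcop).injective (funext fun i => ?_)
  rw [ZMod.prodEquivPi_apply, ZMod.prodEquivPi_apply]
  exact h i

/-- The element of `ZMod (∏ i, q i)` with the given coordinates. -/
def ofCoords (hcop : Pairwise fun i j => (q i).Coprime (q j))
    (x : ∀ i, WithZero (ZMod (q i))ˣ) : ZMod (∏ i, q i) :=
  (ZMod.prodEquivPi q hcop).symm fun i => toZMod (q i) (x i)

theorem coord_ofCoords (hcop : Pairwise fun i j => (q i).Coprime (q j))
    (x : ∀ i, WithZero (ZMod (q i))ˣ) (i : Fin t) :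
    coord q i (ofCoords hcop x) = toZMod (q i) (x i) := by
  rw [coord, ← ZMod.prodEquivPi_apply q hcop, ofCoords, RingEquiv.apply_symm_apply]

open Classical in
/-- The product of the `q i` at which the tuple vanishes. -/
def cofactor (x : ∀ i, WithZero (ZMod (q i))ˣ) : ℕ := ∏ i with x i = 0, q i

theorem cofactor_dvd (x : ∀ i, WithZero (ZMod (q i))ˣ) : cofactor x ∣ ∏ i, q i :=
  prod_dvd_prod_of_subset _ _ _ (filter_subset _ _)

theorem dvd_cofactor {x : ∀ i, WithZero (ZMod (q i))ˣ} {i : Fin t} (hi : x i = 0) :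
    q i ∣ cofactor x := dvd_prod_of_mem q (by simp [hi])

theorem coprime_cofactor (hcop : Pairwise fun i j => (q i).Coprime (q j))
    {x : ∀ i, WithZero (ZMod (q i))ˣ} {i : Fin t} (hi : x i ≠ 0) :
    (cofactor x).Coprime (q i) := by
  refine Nat.Coprime.prod_left fun l hl => hcop ?_
  rintro rfl
  exact hi (by simpa using hl)

theorem isUnit_cofactor (hcop : Pairwise fun i j => (q i).Coprime (q j))
    {x : ∀ i, WithZero (ZMod (q i))ˣ} {i : Fin t} (hi : x i ≠ 0) :
    IsUnit ((cofactor x : ℕ) : ZMod (q i)) :=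
  (ZMod.isUnit_iff_coprime _ _).2 (coprime_cofactor hcop hi)

/-- The element of `ZMod (∏ i, q i)` attached to a tuple: its coordinates are those of the tuple
multiplied by the cofactor. -/
def point (hcop : Pairwise fun i j => (q i).Coprime (q j))
    (x : ∀ i, WithZero (ZMod (q i))ˣ) : ZMod (∏ i, q i) := cofactor x * ofCoords hcop x

/-- The cofactor will be (a, m) for the integer a attached to `x` (`gcd_intPoint`). With this twist
the entries 1 and -1 mean a ≡ ±(a, m) modulo q_i, the congruences occurring in Kučera's conditions.
-/
theorem coord_point (hcop : Pairwise fun i j => (q i).Coprime (q j))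
    (x : ∀ i, WithZero (ZMod (q i))ˣ) (i : Fin t) :
    coord q i (point hcop x) = cofactor x * toZMod (q i) (x i) := by
  rw [point, map_mul, map_natCast, coord_ofCoords]

theorem coord_point_eq_zero_iff (hcop : Pairwise fun i j => (q i).Coprime (q j))
    (h1 : ∀ i, 1 < q i) (x : ∀ i, WithZero (ZMod (q i))ˣ) (i : Fin t) :
    coord q i (point hcop x) = 0 ↔ x i = 0 := by
  rw [coord_point]
  refine ⟨fun h => ?_, fun h => by rw [h, map_zero, mul_zero]⟩
  by_contra hx
  rw [(isUnit_cofactor hcop hx).mul_right_eq_zero] at h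
  exact hx ((toZMod_eq_zero_iff (h1 i)).1 h)

/-- The cofactor depends only on which coordinates vanish, so it is known from `c`, and it can be
divided out at the other coordinates, where it is a unit. -/
theorem exists_point_eq (hcop : Pairwise fun i j => (q i).Coprime (q j)) (h1 : ∀ i, 1 < q i)
    {c : ZMod (∏ i, q i)} (hc : ∀ i, coord q i c = 0 ∨ IsUnit (coord q i c)) :
    ∃ x, point hcop x = c := by
  classical
  choose y hy using fun i => exists_toZMod_eq (hc i)
  have hsupp : ∀ x : ∀ i, WithZero (ZMod (q i))ˣ, (∀ i, x i = 0 ↔ y i = 0) →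
      cofactor x = cofactor y := fun x hx => by
    unfold cofactor
    refine prod_congr ?_ fun _ _ => rfl
    ext i
    simp [hx i]
  have hex : ∀ i, ∃ z : WithZero (ZMod (q i))ˣ, (z = 0 ↔ y i = 0) ∧
      (cofactor y : ZMod (q i)) * toZMod (q i) z = toZMod (q i) (y i) := by
    intro i
    by_cases hi : y i = 0
    · exact ⟨0, by simp [hi], by simp [hi]⟩
    · obtain ⟨g, hg⟩ := exists_toZMod_eq (Or.inr (isUnit_cofactor hcop hi))
      have hg0 : g ≠ 0 := by
        rintro rfl
        have : Fact (1 < q i) := ⟨h1 i⟩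
        exact (isUnit_cofactor hcop hi).ne_zero (by rw [← hg, map_zero])
      exact ⟨g⁻¹ * y i, by simp [hg0], by rw [← hg, ← map_mul, mul_inv_cancel_left₀ hg0]⟩
  choose x hx0 hx using hex
  refine ⟨x, coord_ext hcop fun i => ?_⟩
  rw [coord_point, hsupp x hx0, hx i, hy i]

section Norm

variable [NeZero (∏ i, q i)]

/-- The sawtooth function attached to a tuple. -/
def tupleSaw (hcop : Pairwise fun i j => (q i).Coprime (q j))
    (x : ∀ i, WithZero (ZMod (q i))ˣ) (u : (ZMod (∏ i, q i))ˣ) : ℚ :=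
  saw (∏ i, q i) (-(point hcop x * u))

theorem tupleSaw_odd (hcop : Pairwise fun i j => (q i).Coprime (q j))
    (x : ∀ i, WithZero (ZMod (q i))ˣ) :
    tupleSaw hcop ((fun i => negOne (q i)) * x) = -tupleSaw hcop x := by
  have hc : cofactor ((fun i => negOne (q i)) * x) = cofactor x := by
    unfold cofactor
    refine prod_congr ?_ fun _ _ => rfl
    ext i
    simp [negOne_ne_zero]
  have hp : point hcop ((fun i => negOne (q i)) * x) = -point hcop x := by
    refine coord_ext hcop fun i => ?_
    rw [map_neg, coord_point, coord_point, hc, Pi.mul_apply, map_mul, toZMod_negOne]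
    ring
  ext u
  simp only [tupleSaw, Pi.neg_apply, hp, neg_mul, saw_neg]

open Classical in
-- The difference of two distribution relations: multiplication by q_i leaves coordinate i of `b`
-- free, whereas multiplication by p^k forces it to be a non-unit.
theorem sum_saw_isUnit_coord (hcop : Pairwise fun i j => (q i).Coprime (q j)) {i : Fin t}
    {p k : ℕ} (hp : p.Prime) (hi : q i = p ^ (k + 1)) {a : ZMod (∏ i, q i)}
    (ha : coord q i a = 0) :
    ∑ b with (∀ l, l ≠ i → coord q l b = coord q l a) ∧ IsUnit (coord q i b), saw (∏ i, q i) b =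
      saw (∏ i, q i) (q i * a) - saw (∏ i, q i) ((p ^ k : ℕ) * a) := by
  have hdi : q i ∣ ∏ i, q i := dvd_prod_of_mem q (mem_univ i)
  have hpk : p ^ k ∣ q i := hi ▸ pow_dvd_pow p (Nat.le_succ k)
  have hunit : ∀ l, l ≠ i → ∀ d, d ∣ q i → IsUnit ((d : ℕ) : ZMod (q l)) := fun l hl d hd =>
    (ZMod.isUnit_iff_coprime _ _).2 ((hcop hl.symm).coprime_dvd_left hd)
  have hmul : ∀ d, d ∣ q i → ∀ b : ZMod (∏ i, q i), (d : ZMod (∏ i, q i)) * b = d * a ↔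
      (∀ l, l ≠ i → coord q l b = coord q l a) ∧ (d : ZMod (q i)) * coord q i b = 0 := by
    intro d hd b
    constructor
    · intro h
      refine ⟨fun l hl => ?_, ?_⟩
      · have := congrArg (coord q l) h
        rw [map_mul, map_mul, map_natCast] at this
        exact (hunit l hl d hd).mul_left_cancel this
      · have := congrArg (coord q i) h
        rwa [map_mul, map_mul, map_natCast, ha, mul_zero] at this
    · rintro ⟨h1, h2⟩
      refine coord_ext hcop fun l => ?_
      rw [map_mul, map_mul, map_natCast]
      by_cases hl : l = i
      · subst hl; rw [h2, ha, mul_zero]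
      · rw [h1 l hl]
  have hq0 : q i ≠ 0 := by rw [hi]; exact pow_ne_zero _ hp.ne_zero
  have : NeZero (q i) := ⟨hq0⟩
  have hnonunit : ∀ z : ZMod (q i), ((p ^ k : ℕ) : ZMod (q i)) * z = 0 ↔ ¬ IsUnit z := by
    intro z
    have e : ((p ^ k : ℕ) : ZMod (q i)) * z = ((p ^ k * z.val : ℕ) : ZMod (q i)) := by simp
    have e1 : q i ∣ p ^ k * z.val ↔ p ∣ z.val := by
      have h := Nat.mul_dvd_mul_iff_left (a := p ^ k) (b := p) (c := z.val) (pow_pos hp.pos k)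
      rwa [← pow_succ, ← hi] at h
    rw [e, ZMod.natCast_eq_zero_iff, e1]
    conv_rhs => rw [← ZMod.natCast_zmod_val z]
    rw [ZMod.isUnit_iff_coprime]
    have e2 : z.val.Coprime (q i) ↔ z.val.Coprime (p ^ (k + 1)) := by rw [← hi]
    rw [e2, Nat.coprime_pow_right_iff (Nat.succ_pos k), Nat.coprime_comm, hp.coprime_iff_not_dvd,
      not_not]
  rw [← sum_saw hdi, ← sum_saw (hpk.trans hdi), eq_sub_iff_add_eq,
    ← sum_filter_add_sum_filter_not ({b | (q i : ZMod (∏ i, q i)) * b = q i * a})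
      fun b => IsUnit (coord q i b), filter_filter, filter_filter]
  simp only [hmul _ dvd_rfl, hmul _ hpk, ZMod.natCast_self, zero_mul, hnonunit, and_true]
  congr!

end Norm

/-- The inverse of `p` in the units of `ZMod n`, or `1` if `p` is not coprime to `n`. -/
def frobInv (p n : ℕ) : WithZero (ZMod n)ˣ :=
  if h : p.Coprime n then (((ZMod.unitOfCoprime p h)⁻¹ : (ZMod n)ˣ) : WithZero (ZMod n)ˣ) else 1

theorem frobInv_ne_zero (p n : ℕ) : frobInv p n ≠ 0 := by
  unfold frobInv
  split_ifs
  · exact WithZero.coe_ne_zero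
  · exact one_ne_zero

theorem natCast_mul_toZMod_frobInv {p n : ℕ} (h : p.Coprime n) :
    (p : ZMod n) * toZMod n (frobInv p n) = 1 := by
  rw [frobInv, dif_pos h, toZMod_coe, ← ZMod.coe_unitOfCoprime p h, ← Units.val_mul]
  simp

section TupleSaw

variable [NeZero (∏ i, q i)]

theorem neZero_factor (i : Fin t) : NeZero (q i) :=
  ⟨fun h => NeZero.ne (∏ i, q i) (prod_eq_zero (mem_univ i) h)⟩

open Classical in
-- Filling coordinate i removes q_i from the cofactor and leaves `G`. For `a` built from `G`, the
-- multiple q_i·a gives back `x`, and p^k·a = (q_i/p)·a gives `x` twisted by the inverse Frobenius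
-- of p. At index i `frobInv` has its default value 1, which does not matter because `x i = 0`.
theorem tupleSaw_norm [∀ i, NeZero (q i)] (hq : ∀ i, IsPrimePow (q i))
    (hcop : Pairwise fun i j => (q i).Coprime (q j)) (i : Fin t)
    (x : ∀ i, WithZero (ZMod (q i))ˣ) (hx : x i = 0) :
    ∑ g with g ≠ 0, tupleSaw hcop (Function.update x i g) =
      tupleSaw hcop x - tupleSaw hcop ((fun l => frobInv (q i).minFac (q l)) * x) := by
  have hp : (q i).minFac.Prime := Nat.minFac_prime (hq i).one_lt.ne'
  obtain ⟨k, hk⟩ : ∃ k, q i = (q i).minFac ^ (k + 1) := by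
    obtain ⟨k, hk0, hk⟩ : ∃ k, 0 < k ∧ q i = (q i).minFac ^ k :=
      ⟨(q i).factorization (q i).minFac, hp.factorization_pos_of_dvd (NeZero.ne _)
        (Nat.minFac_dvd _), (hq i).minFac_pow_factorization_eq.symm⟩
    exact ⟨k - 1, by rwa [Nat.sub_add_cancel hk0]⟩
  set p := (q i).minFac with hpdef
  set G : ℕ := ∏ l ∈ ({l | x l = 0} : Finset (Fin t)).erase i, q l with hG
  have hGx : cofactor x = q i * G := (mul_prod_erase _ _ (by simp [hx])).symm
  have hGg : ∀ g ≠ 0, cofactor (Function.update x i g) = G := by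
    intro g hg
    unfold cofactor
    rw [hG]
    refine prod_congr ?_ fun _ _ => rfl
    ext l
    by_cases hl : l = i
    · subst hl; simp [hg]
    · simp [hl]
  have hGu : IsUnit ((G : ℕ) : ZMod (q i)) := by
    rw [← hGg 1 one_ne_zero]
    exact isUnit_cofactor hcop (by simp)
  ext u
  rw [Finset.sum_apply, Pi.sub_apply]
  set a : ZMod (∏ i, q i) := -(G * ofCoords hcop x * u) with ha
  have hai : coord q i a = 0 := by
    rw [ha, map_neg, map_mul, map_mul, coord_ofCoords, hx, map_zero]
    ring
  have h1 : (q i : ZMod (∏ i, q i)) * a = -(point hcop x * u) := by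
    rw [ha, point, hGx]; push_cast; ring
  have h2 : ((p ^ k : ℕ) : ZMod (∏ i, q i)) * a =
      -(point hcop ((fun l => frobInv p (q l)) * x) * u) := by
    have hc : cofactor ((fun l => frobInv p (q l)) * x) = cofactor x := by
      unfold cofactor
      refine prod_congr ?_ fun _ _ => rfl
      ext l
      simp [frobInv_ne_zero]
    have : point hcop ((fun l => frobInv p (q l)) * x) =
        ((p ^ k : ℕ) : ZMod (∏ i, q i)) * (G * ofCoords hcop x) := by
      refine coord_ext hcop fun l => ?_
      rw [coord_point, hc, hGx, map_mul, map_mul, map_natCast, map_natCast, coord_ofCoords,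
        Pi.mul_apply, map_mul]
      by_cases hl : l = i
      · subst hl; rw [hx, map_zero]; ring
      · have hpl : p.Coprime (q l) := (hcop (Ne.symm hl)).coprime_dvd_left (Nat.minFac_dvd _)
        have e := natCast_mul_toZMod_frobInv hpl
        have e2 : ((q i * G : ℕ) : ZMod (q l)) = ((p ^ k : ℕ) : ZMod (q l)) * p * G := by
          rw [hk, pow_succ]; push_cast; ring
        rw [e2]
        linear_combination ((p ^ k : ℕ) : ZMod (q l)) * G * toZMod (q l) (x l) * e
    rw [this, ha]; ring
  have h3 := sum_saw_isUnit_coord hcop hp hk hai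
  rw [h1, h2] at h3
  rw [tupleSaw, tupleSaw, ← h3]
  have hui : IsUnit (coord q i (u : ZMod (∏ i, q i))) := u.isUnit.map _
  have hpt : ∀ g ≠ 0, ∀ l, coord q l (-(point hcop (Function.update x i g) * u)) =
      -(G * toZMod (q l) (Function.update x i g l) * coord q l u) := by
    intro g hg l
    rw [map_neg, map_mul, coord_point, hGg g hg]
  refine sum_bij (fun g _ => -(point hcop (Function.update x i g) * u)) ?_ ?_ ?_ ?_
  · intro g hg
    have hg : g ≠ 0 := by simpa using hg
    simp only [mem_filter, mem_univ, true_and]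
    refine ⟨fun l hl => ?_, ?_⟩
    · rw [hpt g hg, Function.update_of_ne hl, ha, map_neg, map_mul, map_mul, map_natCast,
        coord_ofCoords]
    · rw [hpt g hg, Function.update_self]
      exact ((hGu.mul (isUnit_toZMod hg)).mul hui).neg
  · intro g hg g' hg' h
    have hg : g ≠ 0 := by simpa using hg
    have hg' : g' ≠ 0 := by simpa using hg'
    have h := congrArg (coord q i) h
    rw [hpt g hg, hpt g' hg', Function.update_self, Function.update_self] at h
    exact toZMod_injective (hq i).one_lt
      (hGu.mul_left_cancel (hui.mul_right_cancel (neg_injective h)))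
  · intro b hb
    simp only [mem_filter, mem_univ, true_and] at hb
    obtain ⟨hb1, β, hβ⟩ := hb
    obtain ⟨γ, hγ⟩ := hGu
    obtain ⟨υ, hυ⟩ := hui
    obtain ⟨g, hg⟩ := exists_toZMod_eq (Or.inr (-(γ⁻¹ * β * υ⁻¹)).isUnit : _ ∨ IsUnit
      ((-(γ⁻¹ * β * υ⁻¹) : (ZMod (q i))ˣ) : ZMod (q i)))
    have : Fact (1 < q i) := ⟨(hq i).one_lt⟩
    have hg0 : g ≠ 0 := by
      rintro rfl
      rw [map_zero] at hg
      exact (-(γ⁻¹ * β * υ⁻¹)).isUnit.ne_zero hg.symm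
    refine ⟨g, by simpa using hg0, coord_ext hcop fun l => ?_⟩
    rw [hpt g hg0]
    by_cases hl : l = i
    · subst hl
      rw [Function.update_self, hg, ← hγ, ← hυ, ← hβ, ← Units.val_mul, ← Units.val_mul,
        ← Units.val_neg]
      congr 1
      rw [mul_neg, neg_mul, neg_neg, mul_assoc, mul_assoc, inv_mul_cancel, mul_one,
        mul_inv_cancel_left]
    · rw [Function.update_of_ne hl, hb1 l hl, ha, map_neg, map_mul, map_mul, map_natCast,
        coord_ofCoords]
  · intro g hg
    rfl

theorem tupleSaw_isSignedDistribution [∀ i, NeZero (q i)] (hq : ∀ i, IsPrimePow (q i))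
    (hcop : Pairwise fun i j => (q i).Coprime (q j)) :
    IsSignedDistribution (fun i => negOne (q i)) (fun _ => 1)
      (fun i l => frobInv (q i).minFac (q l)) (tupleSaw hcop) where
  ne_zero_left _ _ := one_ne_zero
  ne_zero_right i l := frobInv_ne_zero _ _
  sign_mul_self := funext fun i => negOne_mul_self
  odd := tupleSaw_odd hcop
  norm i x hx := by
    rw [one_mul, ← tupleSaw_norm hq hcop i x hx]

/-- Every sawtooth function is a sum of those attached to tuples. -/
theorem saw_mem_of_tupleSaw_mem (hq : ∀ i, IsPrimePow (q i))
    (hcop : Pairwise fun i j => (q i).Coprime (q j))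
    {T : AddSubgroup ((ZMod (∏ i, q i))ˣ → ℚ)} (hT : ∀ x, tupleSaw hcop x ∈ T)
    (b : ZMod (∏ i, q i)) : (fun u : (ZMod (∏ i, q i))ˣ => saw (∏ i, q i) (b * u)) ∈ T := by
  classical
  -- `N` collects the factors that b shares with those q_i not dividing it. The distribution
  -- relation replaces b by the solutions c of N·c = b, whose coordinates are all zero or units.
  set N : ℕ := ∏ i with coord q i b ≠ 0, Nat.gcd b.val (q i) with hN
  have hNdvd : N ∣ ∏ i, q i :=
    (prod_dvd_prod_of_dvd _ _ fun i _ => Nat.gcd_dvd_right _ _).trans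
      (prod_dvd_prod_of_subset _ _ _ (filter_subset _ _))
  have hNb : N ∣ b.val := by
    refine Finset.prod_dvd_of_isRelPrime ?_ fun i _ => Nat.gcd_dvd_left _ _
    intro i _ l _ hil
    exact Nat.coprime_iff_isRelPrime.1 <|
      ((hcop hil).coprime_dvd_left (Nat.gcd_dvd_right _ _)).coprime_dvd_right
      (Nat.gcd_dvd_right _ _)
  obtain ⟨c0, hc0⟩ := hNb
  have hb : b = (N : ZMod (∏ i, q i)) * c0 := by
    rw [← ZMod.natCast_zmod_val b, hc0]; push_cast; rfl
  have hsum : (fun u : (ZMod (∏ i, q i))ˣ => saw (∏ i, q i) (b * u)) =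
      ∑ c with (N : ZMod (∏ i, q i)) * c = b, fun u : (ZMod (∏ i, q i))ˣ =>
        saw (∏ i, q i) (c * u) := by
    ext u
    rw [Finset.sum_apply, show b * (u : ZMod (∏ i, q i)) = N * (c0 * u) by rw [hb]; ring,
      ← sum_saw hNdvd]
    symm
    refine sum_bij' (fun c _ => c * u) (fun c _ => c * (u⁻¹ : (ZMod (∏ i, q i))ˣ)) ?_ ?_ ?_ ?_ ?_
    · intro c hc
      have hc := (mem_filter.1 hc).2
      rw [mem_filter]
      refine ⟨mem_univ _, ?_⟩
      rw [← mul_assoc, hc, hb]; ring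
    · intro c hc
      have hc := (mem_filter.1 hc).2
      rw [mem_filter]
      refine ⟨mem_univ _, ?_⟩
      rw [← mul_assoc, hc, hb, ← mul_assoc, mul_assoc, Units.mul_inv, mul_one]
    · intro c _; simp
    · intro c _; simp
    · intro c _; rfl
  rw [hsum]
  refine T.sum_mem fun c hc => ?_
  have hc := (mem_filter.1 hc).2
  have hcoord : ∀ i, coord q i c = 0 ∨ IsUnit (coord q i c) := by
    intro i
    have h1 := congrArg (coord q i) hc
    rw [map_mul, map_natCast] at h1
    by_cases hi : coord q i b = 0
    · left
      have hu : IsUnit ((N : ℕ) : ZMod (q i)) := by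
        rw [ZMod.isUnit_iff_coprime]
        refine Nat.Coprime.prod_left fun l hl => ?_
        have hl : coord q l b ≠ 0 := by simpa using hl
        refine (hcop ?_).coprime_dvd_left (Nat.gcd_dvd_right _ _)
        rintro rfl
        exact hl hi
      rw [hi] at h1
      exact hu.mul_right_eq_zero.1 h1
    · right
      have := neZero_factor (q := q) i
      obtain ⟨p, k, hp, hk0, hpk⟩ := (isPrimePow_nat_iff _).1 (hq i)
      set z := coord q i c with hz
      have e : z.val.Coprime (q i) ↔ z.val.Coprime (p ^ k) := by rw [hpk]
      rw [← ZMod.natCast_zmod_val z, ZMod.isUnit_iff_coprime, e,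
        Nat.coprime_pow_right_iff hk0, Nat.coprime_comm, hp.coprime_iff_not_dvd]
      -- If p divided this coordinate of c, then N·c ≡ b would be divisible by one more power of p
      -- than gcd(b, q_i) allows.
      intro hpz
      have hbi : coord q i b = (b.val : ZMod (q i)) := by
        rw [← map_natCast (coord q i), ZMod.natCast_zmod_val]
      have h2 : N * z.val ≡ b.val [MOD q i] := by
        rw [← ZMod.natCast_eq_natCast_iff]
        push_cast
        rw [ZMod.natCast_zmod_val, h1, hbi]
      obtain ⟨v, hv, hgv⟩ := (Nat.dvd_prime_pow hp).1 (hpk ▸ Nat.gcd_dvd_right b.val (q i))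
      have hvk : v < k := by
        refine lt_of_le_of_ne hv ?_
        rintro rfl
        apply hi
        rw [hbi, ZMod.natCast_eq_zero_iff, ← hpk, ← hgv]
        rw [hpk]
        exact Nat.gcd_dvd_left _ _
      have h3 : p ^ (v + 1) ∣ q i := hpk ▸ pow_dvd_pow p hvk
      have h4 : p ^ (v + 1) ∣ N * z.val := by
        rw [pow_succ]
        refine mul_dvd_mul ?_ hpz
        rw [← hgv, hpk]
        exact dvd_prod_of_mem (fun i => Nat.gcd b.val (q i)) (by simp [hi])
      have h5 : p ^ (v + 1) ∣ b.val := (h2.dvd_iff h3).1 h4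
      have h6 := Nat.dvd_gcd h5 h3
      rw [← hpk, hgv] at h6
      exact absurd ((Nat.pow_dvd_pow_iff_le_right hp.one_lt).1 h6) (by omega)
  -- Negated because `tupleSaw` evaluates the sawtooth at minus the point.
  have hcoord' : ∀ i, coord q i (-c) = 0 ∨ IsUnit (coord q i (-c)) := fun i => by
    rw [map_neg, neg_eq_zero, IsUnit.neg_iff]; exact hcoord i
  obtain ⟨x, hx⟩ := exists_point_eq hcop (fun i => (hq i).one_lt) hcoord'
  have : tupleSaw hcop x = fun u : (ZMod (∏ i, q i))ˣ => saw (∏ i, q i) (c * u) := by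
    ext u
    rw [tupleSaw, hx]
    simp
  rw [← this]
  exact hT x

end TupleSaw

/-! ### Comparison of Kučera's set M_m with the abstract set of tuples. -/

section IntPoint

/-- The integer in `[0, ∏ i, q i)` attached to a tuple. -/
def intPoint (hcop : Pairwise fun i j => (q i).Coprime (q j))
    (x : ∀ i, WithZero (ZMod (q i))ˣ) : ℤ := (point hcop x).val

variable (hcop : Pairwise fun i j => (q i).Coprime (q j))

theorem exists_intPoint_eq (h1 : ∀ i, 1 < q i) {a : ℤ} (ha : a ∈ setX (∏ i, q i) q) :
    ∃ x : ∀ i, WithZero (ZMod (q i))ˣ, x ≠ 0 ∧ intPoint hcop x = a := by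
  obtain ⟨h0, hlt, hdvd⟩ := ha
  lift a to ℕ using h0.le
  obtain ⟨x, hx⟩ := exists_point_eq hcop h1 (c := (a : ZMod (∏ i, q i))) fun i => by
    rw [map_natCast]
    refine (hdvd i).imp (fun h => ?_) fun h => ?_
    · exact (ZMod.natCast_eq_zero_iff _ _).2 (Int.natCast_dvd_natCast.1 h)
    · rwa [ZMod.isUnit_iff_coprime, ← Nat.isCoprime_iff_coprime]
  have e : intPoint hcop x = a := by
    rw [intPoint, hx, ZMod.val_natCast, Nat.mod_eq_of_lt (Int.ofNat_lt.1 hlt)]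
  refine ⟨x, ?_, e⟩
  rintro rfl
  have h : point hcop (0 : ∀ i, WithZero (ZMod (q i))ˣ) = 0 :=
    coord_ext hcop fun i => by rw [map_zero, coord_point_eq_zero_iff hcop h1]; rfl
  rw [intPoint, h, ZMod.val_zero] at e
  omega

variable [NeZero (∏ i, q i)]

theorem intPoint_cast (x : ∀ i, WithZero (ZMod (q i))ˣ) :
    ((intPoint hcop x : ℤ) : ZMod (∏ i, q i)) = point hcop x := by
  rw [intPoint, Int.cast_natCast, ZMod.natCast_zmod_val]

theorem intPoint_cast_factor (x : ∀ i, WithZero (ZMod (q i))ˣ) (i : Fin t) :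
    ((intPoint hcop x : ℤ) : ZMod (q i)) = cofactor x * toZMod (q i) (x i) := by
  rw [← coord_point hcop x i, ← intPoint_cast, map_intCast]

theorem dvd_intPoint_iff (h1 : ∀ i, 1 < q i)
    (x : ∀ i, WithZero (ZMod (q i))ˣ) (i : Fin t) : (q i : ℤ) ∣ intPoint hcop x ↔ x i = 0 := by
  rw [← ZMod.intCast_zmod_eq_zero_iff_dvd, intPoint_cast_factor, ← coord_point hcop x i,
    coord_point_eq_zero_iff hcop h1]

theorem gcd_intPoint (h1 : ∀ i, 1 < q i)
    (x : ∀ i, WithZero (ZMod (q i))ˣ) : Int.gcd (intPoint hcop x) (∏ i, q i : ℕ) = cofactor x := by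
  rw [intPoint, Int.gcd_natCast_natCast]
  refine Nat.dvd_antisymm ?_ (Nat.dvd_gcd ?_ (cofactor_dvd x))
  · have hsplit : (∏ i, q i) = cofactor x * ∏ i with ¬ x i = 0, q i := by
      classical
      rw [cofactor]
      convert (prod_filter_mul_prod_filter_not univ (fun i => x i = 0) q).symm
    refine Nat.Coprime.dvd_of_dvd_mul_right (n := ∏ i with ¬ x i = 0, q i) ?_
      (hsplit ▸ Nat.gcd_dvd_right _ _)
    refine Nat.Coprime.prod_right fun i hi => ?_
    have hi : x i ≠ 0 := by simpa using hi
    refine Nat.Coprime.coprime_dvd_left (Nat.gcd_dvd_left _ _) ?_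
    rw [← ZMod.isUnit_iff_coprime, ← Int.cast_natCast, ← intPoint, intPoint_cast_factor]
    exact (isUnit_cofactor hcop hi).mul (isUnit_toZMod hi)
  · classical
    refine Finset.prod_dvd_of_isRelPrime (fun i _ l _ hil =>
      Nat.coprime_iff_isRelPrime.1 (hcop hil)) fun i hi => ?_
    have hi : x i = 0 := by simpa using hi
    exact Int.natCast_dvd_natCast.1 ((dvd_intPoint_iff hcop h1 x i).2 hi)

theorem intPoint_modEq_iff (h1 : ∀ i, 1 < q i)
    (x : ∀ i, WithZero (ZMod (q i))ˣ) (i : Fin t) :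
    intPoint hcop x ≡ (cofactor x : ℤ) [ZMOD q i] ↔ (x i ≠ 0 → x i = 1) := by
  rw [← ZMod.intCast_eq_intCast_iff, intPoint_cast_factor, Int.cast_natCast]
  by_cases hi : x i = 0
  · simp [hi, (ZMod.natCast_eq_zero_iff _ _).2 (dvd_cofactor hi)]
  · simp only [ne_eq, hi, not_false_eq_true, forall_true_left]
    rw [(isUnit_cofactor hcop hi).mul_eq_left, ← map_one (toZMod (q i)),
      (toZMod_injective (h1 i)).eq_iff]

theorem intPoint_modEq_neg_iff (h1 : ∀ i, 1 < q i)
    (x : ∀ i, WithZero (ZMod (q i))ˣ) {i : Fin t} (hi : x i ≠ 0) :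
    intPoint hcop x ≡ -(cofactor x : ℤ) [ZMOD q i] ↔ x i = negOne (q i) := by
  rw [← ZMod.intCast_eq_intCast_iff, intPoint_cast_factor, Int.cast_neg, Int.cast_natCast,
    ← mul_neg_one, (isUnit_cofactor hcop hi).mul_right_inj, ← toZMod_negOne,
    (toZMod_injective (h1 i)).eq_iff]

/-- The integer a/(a, m) is congruent to the coordinate `x k` modulo q_k. -/
theorem fract_intPoint_lt_iff (h1 : ∀ i, 1 < q i)
    (x : ∀ i, WithZero (ZMod (q i))ˣ) [∀ i, NeZero (q i)] {k : Fin t} (hk : x k ≠ 0) :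
    Int.fract ((intPoint hcop x : ℚ) / ((cofactor x : ℚ) * q k)) < 1 / 2 ↔
      x k ∈ lowerHalf (q k) := by
  obtain ⟨b, hb⟩ : (cofactor x : ℤ) ∣ intPoint hcop x := by
    rw [← gcd_intPoint hcop h1 x]; exact Int.gcd_dvd_left _ _
  have hc0 : cofactor x ≠ 0 := fun h =>
    NeZero.ne (∏ i, q i) (Nat.eq_zero_of_zero_dvd (h ▸ cofactor_dvd x))
  have hbk : (b : ZMod (q k)) = toZMod (q k) (x k) := by
    have h := intPoint_cast_factor hcop x k
    rw [hb, Int.cast_mul, Int.cast_natCast] at h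
    exact (isUnit_cofactor hcop hk).mul_left_cancel h
  have hc0' : (cofactor x : ℚ) ≠ 0 := by exact_mod_cast hc0
  have hq0 : (0 : ℚ) < q k := by exact_mod_cast NeZero.pos (q k)
  rw [hb, Int.cast_mul, Int.cast_natCast, mul_div_mul_left _ _ hc0', fract_intCast_div, hbk,
    mem_lowerHalf hk, div_lt_div_iff₀ hq0 two_pos, one_mul]
  constructor
  · intro h
    have : (((toZMod (q k) (x k)).val * 2 : ℕ) : ℚ) < (q k : ℕ) := by push_cast; exact h
    have := Nat.cast_lt.1 this
    omega
  · intro h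
    have : (((toZMod (q k) (x k)).val * 2 : ℕ) : ℚ) < (q k : ℕ) := Nat.cast_lt.2 (by omega)
    push_cast at this; exact this

theorem intPoint_mem_setX (h1 : ∀ i, 1 < q i)
    (x : ∀ i, WithZero (ZMod (q i))ˣ) (hx : x ≠ 0) : intPoint hcop x ∈ setX (∏ i, q i) q := by
  obtain ⟨i, hi⟩ := Function.ne_iff.1 hx
  refine ⟨lt_of_le_of_ne (Int.natCast_nonneg _) fun h => hi ?_, ?_, fun i => ?_⟩
  · exact (dvd_intPoint_iff hcop h1 x i).1 (h ▸ dvd_zero _)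
  · exact Int.ofNat_lt.2 (ZMod.val_lt _)
  · by_cases hi : x i = 0
    · exact Or.inl ((dvd_intPoint_iff hcop h1 x i).2 hi)
    · right
      rw [intPoint, Nat.isCoprime_iff_coprime, ← ZMod.isUnit_iff_coprime, ← Int.cast_natCast,
        ← intPoint, intPoint_cast_factor]
      exact (isUnit_cofactor hcop hi).mul (isUnit_toZMod hi)

/-- A positive divisor of m equals its gcd with m. Conversely, entries in {0, 1} make the point the
residue of the cofactor, which is a proper divisor of m because the integer is nonzero. -/
theorem intPoint_dvd_iff (h1 : ∀ i, 1 < q i) (x : ∀ i, WithZero (ZMod (q i))ˣ) (hx : x ≠ 0) :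
    intPoint hcop x ∣ (∏ i, q i : ℕ) ↔ ∀ i, x i ≠ 0 → x i = 1 := by
  constructor
  · intro h i
    rw [← intPoint_modEq_iff hcop h1, ← gcd_intPoint hcop h1 x, Int.gcd_eq_natAbs_left h,
      Int.natAbs_of_nonneg (a := intPoint hcop x) (Int.natCast_nonneg _)]
  · intro h
    have e : point hcop x = (cofactor x : ZMod (∏ i, q i)) := by
      refine coord_ext hcop fun i => ?_
      rw [map_natCast, ← intPoint_cast, map_intCast, ← Int.cast_natCast,
        ZMod.intCast_eq_intCast_iff, intPoint_modEq_iff hcop h1]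
      exact h i
    have h0 := (intPoint_mem_setX hcop h1 x hx).1
    rw [intPoint, e, ZMod.val_natCast] at h0
    rw [intPoint, e, ZMod.val_natCast, Int.natCast_dvd_natCast]
    rcases (Nat.le_of_dvd (NeZero.pos _) (cofactor_dvd x)).eq_or_lt with h' | h'
    · rw [h', Nat.mod_self] at h0
      exact absurd h0 (lt_irrefl _)
    · rw [Nat.mod_eq_of_lt h']
      exact cofactor_dvd x

/-- The greatest index with a ≢ (a, m) modulo q_k is the last coordinate different from 0 and 1, so
the conditions match one by one. -/
theorem intPoint_mem_setM_iff (h1 : ∀ i, 1 < q i)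
    (x : ∀ i, WithZero (ZMod (q i))ˣ) [∀ i, NeZero (q i)] (hx : x ≠ 0) :
    intPoint hcop x ∈ setM (∏ i, q i) q ↔
      x ∈ kuceraSet (fun i => negOne (q i)) fun i => lowerHalf (q i) := by
  have hcard : {i | ¬ (q i : ℤ) ∣ intPoint hcop x}.ncard = #(supp x) := by
    rw [← Set.ncard_coe_finset]
    congr 1
    ext i
    simp [dvd_intPoint_iff hcop h1, mem_supp]
  rw [setM, Set.mem_ofPred_eq, kuceraSet, Set.mem_ofPred_eq,
    and_iff_right (intPoint_mem_setX hcop h1 x hx), gcd_intPoint hcop h1, intPoint_dvd_iff hcop h1 x hx, hcard]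
  refine and_congr (forall_congr' fun i => ?_) (and_congr_left fun _ => ?_)
  · rw [dvd_intPoint_iff hcop h1]
    exact imp_congr_right fun hi => not_congr (intPoint_modEq_neg_iff hcop h1 x hi)
  · simp only [intPoint_modEq_iff hcop h1]
    constructor
    · intro h k hk hk1 hmax
      rw [← fract_intPoint_lt_iff hcop h1 x hk]
      refine h (fun h' => hk1 (h' k hk)) k ⟨fun h' => hk1 (h' hk), fun i hi => ?_⟩
      by_contra hki
      exact hi (hmax i (not_le.1 hki))
    · intro h _ k hk
      have hk0 : x k ≠ 0 := fun h' => hk.1 fun h'' => absurd h' h''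
      rw [fract_intPoint_lt_iff hcop h1 x hk0]
      refine h k hk0 (fun h' => hk.1 fun _ => h') fun i hi => ?_
      by_contra h'
      exact absurd (hk.2 h') (not_le.2 hi)

end IntPoint

/-- The sawtooth function underlying `ω_m(a)`. -/
def omegaFun (m : ℕ) (a : ℤ) (u : (ZMod m)ˣ) : ℚ := saw m (-(a * (u : ZMod m)))

/-! ### Generation and independence of the functions attached to M_m. -/

section Basis

theorem finite_setM (m : ℕ) (q : Fin t → ℕ) : (setM m q).Finite :=
  (Set.finite_Ioo (0 : ℤ) m).subset fun _ ha => ⟨ha.1.1, ha.1.2.1⟩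

theorem prod_totient (hcop : Pairwise fun i j => (q i).Coprime (q j)) :
    (∏ i, q i).totient = ∏ i, (q i).totient := by
  classical
  suffices ∀ s : Finset (Fin t), (∏ i ∈ s, q i).totient = ∏ i ∈ s, (q i).totient from this univ
  intro s
  induction s using Finset.induction_on with
  | empty => simp
  | insert i s hi ih =>
    rw [prod_insert hi, prod_insert hi, Nat.totient_mul, ih]
    refine Nat.Coprime.prod_right fun l hl => hcop ?_
    rintro rfl
    exact hi hl

/-- A factor equal to 2 would leave an odd cofactor, whence m ≡ 2 modulo 4. -/
theorem two_lt_factor (hq : ∀ i, IsPrimePow (q i))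
    (hcop : Pairwise fun i j => (q i).Coprime (q j)) (h4 : (∏ i, q i) % 4 ≠ 2) (i : Fin t) :
    2 < q i := by
  refine lt_of_le_of_ne (hq i).two_le fun h => h4 ?_
  have hodd : Odd (∏ l ∈ univ.erase i, q l) := by
    rw [← Nat.coprime_two_left, h]
    exact Nat.Coprime.prod_right fun l hl => hcop (ne_of_mem_erase hl).symm
  rw [← mul_prod_erase univ q (mem_univ i), ← h]
  obtain ⟨k, hk⟩ := hodd
  omega

variable [NeZero (∏ i, q i)]

theorem two_mul_card_setM_le [Nonempty (Fin t)] (hcop : Pairwise fun i j => (q i).Coprime (q j))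
    (h2 : ∀ i, 2 < q i) : 2 * Nat.card (setM (∏ i, q i) q) ≤ (∏ i, q i).totient := by
  have h1 : ∀ i, 1 < q i := fun i => (h2 i).trans' one_lt_two
  have : ∀ i, NeZero (q i) := neZero_factor
  have hle : (setM (∏ i, q i) q).ncard ≤
      (kuceraSet (fun i => negOne (q i)) fun i => lowerHalf (q i)).ncard := by
    refine (Set.ncard_le_ncard (t := intPoint hcop '' _) ?_ (Set.toFinite _)).trans
      (Set.ncard_image_le (Set.toFinite _))
    intro a ha
    obtain ⟨x, hx, rfl⟩ := exists_intPoint_eq hcop h1 ha.1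
    exact ⟨x, (intPoint_mem_setM_iff hcop h1 x hx).1 ha, rfl⟩
  have h := two_mul_ncard_kuceraSet_le (j := fun i => negOne (q i)) (H := fun i => lowerHalf (q i))
    (fun i => negOne_ne_one (h2 i)) (funext fun i => negOne_mul_self)
    (fun i x hx => negOne_mul_mem_lowerHalf (h2 i) hx)
  simp only [card_withZero_units, ← prod_totient hcop] at h
  exact (Nat.mul_le_mul_left 2 hle).trans h

theorem saw_mem_closure_omegaFun (hq : ∀ i, IsPrimePow (q i))
    (hcop : Pairwise fun i j => (q i).Coprime (q j)) (h2 : ∀ i, 2 < q i)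
    {T : AddSubgroup ((ZMod (∏ i, q i))ˣ → ℚ)}
    (hT : ∀ a ∈ setM (∏ i, q i) q, omegaFun (∏ i, q i) a ∈ T) (b : ZMod (∏ i, q i)) :
    (fun u : (ZMod (∏ i, q i))ˣ => saw (∏ i, q i) (b * u)) ∈ T := by
  have h1 : ∀ i, 1 < q i := fun i => (h2 i).trans' one_lt_two
  have : ∀ i, NeZero (q i) := neZero_factor
  refine saw_mem_of_tupleSaw_mem hq hcop (fun x => ?_) b
  refine (tupleSaw_isSignedDistribution hq hcop).mem_of_kuceraSet
    (H := fun i => lowerHalf (q i)) ?_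
    (fun i x hx => negOne_mul_mem_lowerHalf (h2 i) hx) (fun i => one_mem_lowerHalf (h2 i)) ?_ x
  · intro v hv
    ext u
    have := congrFun hv u
    simp only [Pi.add_apply, Pi.zero_apply] at this ⊢
    linarith
  · intro x hx
    have hx0 : x ≠ 0 := by
      rintro rfl
      have := hx.2.2 fun i hi => absurd rfl hi
      simp [supp] at this
    have := hT _ ((intPoint_mem_setM_iff hcop h1 x hx0).2 hx)
    convert this using 1
    ext u
    rw [omegaFun, intPoint_cast, tupleSaw]

theorem linearIndependent_omegaFun [Nonempty (Fin t)] (hq : ∀ i, IsPrimePow (q i))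
    (hcop : Pairwise fun i j => (q i).Coprime (q j)) (h2 : ∀ i, 2 < q i) :
    LinearIndependent ℤ (Sum.elim (fun a : setM (∏ i, q i) q => omegaFun (∏ i, q i) a)
      fun _ : Unit => fun _ => (1 / 2 : ℚ)) := by
  have : Finite (setM (∏ i, q i) q) := finite_setM _ q
  have hm : 2 < ∏ i, q i := by
    obtain ⟨i⟩ := ‹Nonempty (Fin t)›
    exact (h2 i).trans_le (Nat.le_of_dvd (NeZero.pos _) (dvd_prod_of_mem q (mem_univ i)))
  refine linearIndependent_of_saw_mem_span hm (two_mul_card_setM_le hcop h2) _ fun b => ?_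
  exact saw_mem_closure_omegaFun hq hcop h2
    (T := (Submodule.span ℤ (Set.range fun a : setM (∏ i, q i) q =>
      omegaFun (∏ i, q i) a)).toAddSubgroup)
    (fun a ha => Submodule.subset_span ⟨⟨a, ha⟩, rfl⟩) b

theorem halfSawGroup_eq_span (hq : ∀ i, IsPrimePow (q i))
    (hcop : Pairwise fun i j => (q i).Coprime (q j)) (h2 : ∀ i, 2 < q i) :
    halfSawGroup (∏ i, q i) = (Submodule.span ℤ (Set.range (Sum.elim
      (fun a : setM (∏ i, q i) q => omegaFun (∏ i, q i) a)
      fun _ : Unit => fun _ => (1 / 2 : ℚ)))).toAddSubgroup := by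
  set f : setM (∏ i, q i) q ⊕ Unit → ((ZMod (∏ i, q i))ˣ → ℚ) :=
    Sum.elim (fun a => omegaFun (∏ i, q i) a) fun _ => fun _ => (1 / 2 : ℚ) with hf
  have hmem : ∀ k, f k ∈ (Submodule.span ℤ (Set.range f)).toAddSubgroup := fun k =>
    Submodule.subset_span (Set.mem_range_self k)
  refine le_antisymm (sup_le ?_ ?_) ?_
  · rw [sawGroup, AddSubgroup.closure_le]
    rintro _ ⟨b, rfl⟩
    exact saw_mem_closure_omegaFun hq hcop h2 (T := (Submodule.span ℤ (Set.range f)).toAddSubgroup)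
      (fun a ha => hmem (Sum.inl ⟨a, ha⟩)) b
  · rw [AddSubgroup.zmultiples_le]
    exact hmem (Sum.inr ())
  · rw [← AddSubgroup.toIntSubmodule_toAddSubgroup (halfSawGroup _)]
    refine Submodule.span_le.2 ?_
    rintro _ ⟨a | a, rfl⟩
    · refine AddSubgroup.mem_sup_left ?_
      convert saw_mem_sawGroup (-(a : ℤ) : ZMod (∏ i, q i)) using 1
      ext u
      simp [hf, omegaFun]
    · exact half_mem_halfSawGroup _

end Basis

end Stickelberger

end

open Stickelberger in
/-- For `m > 1`, `m ≢ 2 (mod 4)`, and any ordering `m = q_1 ⋯ q_t` of the factorization of `m` into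
powers of distinct primes, the `ω_m(a)`, `a ∈ M_m`, together with `½ N_m` form a `ℤ`-basis of
`S'_m`. -/
theorem mainTheorem5 (m : ℕ) [NeZero m] (hm : 1 < m) (hm4 : m % 4 ≠ 2)
    (t : ℕ) (q : Fin t → ℕ) (hq : ∀ i, IsPrimePow (q i))
    (hcop : Pairwise fun i j => (q i).Coprime (q j)) (hprod : ∏ i, q i = m) :
    ∃ b : Module.Basis (setM m q ⊕ Unit) ℤ (sinnottGroup m),
      (∀ a : setM m q, (b (Sum.inl a) : ℚ[G m]) = omega m a) ∧
      (b (Sum.inr ()) : ℚ[G m]) = (1 / 2 : ℚ) • normElt m := by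
  subst hprod
  have h2 := two_lt_factor hq hcop hm4
  -- With no factors the product would be 1.
  have : Nonempty (Fin t) := by
    by_contra h
    rw [not_nonempty_iff] at h
    simp at hm
  set f : setM (∏ i, q i) q ⊕ Unit → ((ZMod (∏ i, q i))ˣ → ℚ) :=
    Sum.elim (fun a => omegaFun (∏ i, q i) a) fun _ => fun _ => (1 / 2 : ℚ) with hf
  have hS : sinnottGroup (∏ i, q i) =
      (Submodule.span ℤ (Set.range f)).toAddSubgroup.map
        (ofFun (∏ i, q i)).toAddMonoidHom := by
    rw [sinnottGroup_eq, halfSawGroup_eq_span hq hcop h2]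
  have hmem : ∀ k, ofFun (∏ i, q i) (f k) ∈ sinnottGroup (∏ i, q i) := fun k => by
    rw [hS]
    exact ⟨f k, Submodule.subset_span ⟨k, rfl⟩, rfl⟩
  let L : ((ZMod (∏ i, q i))ˣ → ℚ) →ₗ[ℤ] ℚ[G (∏ i, q i)] :=
    (ofFun (∏ i, q i)).toAddMonoidHom.toIntLinearMap
  let ι : sinnottGroup (∏ i, q i) →ₗ[ℤ] ℚ[G (∏ i, q i)] :=
    (sinnottGroup (∏ i, q i)).subtype.toIntLinearMap
  let v : setM (∏ i, q i) q ⊕ Unit → sinnottGroup (∏ i, q i) := fun k =>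
    ⟨ofFun (∏ i, q i) (f k), hmem k⟩
  have hli : LinearIndependent ℤ v := by
    refine LinearIndependent.of_comp ι ?_
    exact (linearIndependent_omegaFun hq hcop h2).map' L
      (LinearMap.ker_eq_bot.2 (ofFun_injective _))
  have hspan : ⊤ ≤ Submodule.span ℤ (Set.range v) := by
    rintro ⟨x, hx⟩ -
    obtain ⟨g, hg, rfl⟩ := hS ▸ hx
    have h3 : L g ∈ (Submodule.span ℤ (Set.range v)).map ι := by
      rw [Submodule.map_span, ← Set.range_comp]
      have := Submodule.mem_map_of_mem (f := L) hg
      rwa [Submodule.map_span, ← Set.range_comp] at this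
    obtain ⟨y, hy, hyx⟩ := h3
    rwa [← show y = ⟨_, hx⟩ from Subtype.ext hyx]
  refine ⟨Module.Basis.mk hli hspan, fun a => ?_, ?_⟩
  · rw [Module.Basis.mk_apply, omega_eq]
    rfl
  · rw [Module.Basis.mk_apply, normElt_eq, ← map_smul]
    change ofFun _ _ = _
    congr 1
    ext u
    simp [hf]
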